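/- \textbf{Theorem.} Model: a word RAM with $w$-bit words whose unit-cost instructions are register moves and constants, the usual arithmetic, bitwise and shift operations, comparisons and jumps, reading and writing a working memory, reading a word of a read-only data structure, appending a word to the output, and one oracle call ``is $A[k]\ge t$?'' for an index $k$ held in a register. The sequence $A$ and the threshold $t$ are accessible at query time only through this oracle, and the space of a data structure is the number of its words times $w$. (a) For every constant $\kappa$ there are a word RAM program and constants $c,C$ such that for all $n$, all word lengths $w$ with $\log_2(n+1)\le w\le\kappa(\lfloor\log_2 n\rfloor+1)$ (where $\lfloor\log_2 0\rfloor:=0$), and every sequence $A[0..n-1]$ over a linearly ordered set, there is a data structure of at most $cn$ bits with the following property: for every query $0\le l\le r<n$ and every threshold $t$, the program, given $l$, $r$, the data structure and the oracle for $(A,t)$, halts after at most $C(|\mathrm{output}|+1)$ steps and reports every element of $$\mathrm{output}=\{k : l\le k\le r,\ A[k]\ge t\}$$ exactly once, and nothing else. (b) For integers $x\le y$ in $[0,n-1]$ let $\mathrm{RMQ}(x,y)$ be any choice of an index of a maximum of $A[x],\dots,A[y]$. Let $\mathrm{range}(x,y)$ be the recursive procedure that returns at once if $x>y$; otherwise it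 sets $id=\mathrm{RMQ}(x,y)$ and, if $A[id]\ge t$, adds $id$ to a set $\mathrm{ans}$ (initially empty) and calls $\mathrm{range}(x,id-1)$ and $\mathrm{range}(id+1,y)$. Then for all $0\le l\le r<n$ and all $t$, $\mathrm{range}(l,r)$ terminates with $\mathrm{ans}=\{k: l\le k\le r,\ A[k]\ge t\}$, and the total number of calls of $\mathrm{range}$, the initial one included, is at most $2|\mathrm{output}|+1$. -/

import Mathlib

universe u

namespace RangeReport

/-- The binary operations of the word RAM, on unsigned `w`-bit words (arithmetic modulo `2 ^ w`). -/
inductive BinOp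
  | add | sub | mul | div | mod | band | bor | bxor | shl | shr

/-- Semantics of the binary operations.  Division by zero gives zero, and a shift by `w` or
more positions gives zero. -/
def BinOp.eval {w : ℕ} : BinOp → BitVec w → BitVec w → BitVec w
  | .add, x, y => x + y
  | .sub, x, y => x - y
  | .mul, x, y => x * y
  | .div, x, y => x / y
  | .mod, x, y => x % y
  | .band, x, y => x &&& y
  | .bor, x, y => x ||| y
  | .bxor, x, y => x ^^^ y
  | .shl, x, y => x <<< y
  | .shr, x, y => x >>> y

/-- Instructions of a word RAM.  `d`, `a`, `b` are register numbers and `p` is a position in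
the program.  A program may use any fixed finite number of registers. -/
inductive Instr
  /-- `R[d] := c mod 2 ^ w` -/
  | const (d c : ℕ)
  /-- `R[d] := R[a]` -/
  | move (d a : ℕ)
  /-- `R[d] := R[a] o R[b]` -/
  | bin (o : BinOp) (d a b : ℕ)
  /-- `R[d] := M[R[a]]`, where `M` is the working memory -/
  | load (d a : ℕ)
  /-- `M[R[a]] := R[b]` -/
  | store (a b : ℕ)
  /-- `R[d] := I[R[a]]`, where `I` is the read-only data structure -/
  | look (d a : ℕ)
  /-- `R[d] := 1` if the oracle accepts `R[a]`, and `R[d] := 0` otherwise -/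
  | ask (d a : ℕ)
  /-- append `R[a]` to the output -/
  | emit (a : ℕ)
  /-- continue at position `p` -/
  | jump (p : ℕ)
  /-- continue at position `p` if `R[a] = R[b]` -/
  | jumpEq (a b p : ℕ)
  /-- continue at position `p` if `R[a] < R[b]` (unsigned) -/
  | jumpLt (a b p : ℕ)
  /-- stop -/
  | halt

/-- A program is a finite list of instructions. -/
abbrev Program := List Instr

/-- Configurations of the word RAM with words of `w` bits.  The program counter belongs to the
finite control. -/
structure Config (w : ℕ) where
  pc : ℕ
  reg : ℕ → BitVec w
  mem : BitVec w → BitVec w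
  out : List (BitVec w)

variable {w : ℕ}

/-- Write `v` to register `d` and go on to the next instruction. -/
def Config.setReg (s : Config w) (d : ℕ) (v : BitVec w) : Config w :=
  { s with pc := s.pc + 1, reg := Function.update s.reg d v }

/-- The effect of one instruction, for the data structure `I` and the oracle `orc`.
Reading `I` past its end gives zero. -/
def Instr.exec (I : List (BitVec w)) (orc : BitVec w → Bool) (s : Config w) : Instr → Config w
  | .const d c => s.setReg d (BitVec.ofNat w c)
  | .move d a => s.setReg d (s.reg a)
  | .bin o d a b => s.setReg d (o.eval (s.reg a) (s.reg b))
  | .load d a => s.setReg d (s.mem (s.reg a))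
  | .store a b =>
      { s with pc := s.pc + 1, mem := Function.update s.mem (s.reg a) (s.reg b) }
  | .look d a => s.setReg d (I.getD (s.reg a).toNat 0)
  | .ask d a => s.setReg d (if orc (s.reg a) then 1 else 0)
  | .emit a => { s with pc := s.pc + 1, out := s.out ++ [s.reg a] }
  | .jump p => { s with pc := p }
  | .jumpEq a b p => { s with pc := if s.reg a = s.reg b then p else s.pc + 1 }
  | .jumpLt a b p => { s with pc := if s.reg a < s.reg b then p else s.pc + 1 }
  | .halt => s

/-- The instruction to be executed next; past the end of the program it is `halt`. -/
def Config.current (P : Program) (s : Config w) : Instr := P.getD s.pc .halt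

/-- One step of the machine; it costs one unit of time, a call of the oracle included.
Halted configurations do not change. -/
def step (P : Program) (I : List (BitVec w)) (orc : BitVec w → Bool) (s : Config w) : Config w :=
  (s.current P).exec I orc s

/-- The initial configuration of a query: the two arguments are in registers `0` and `1`. -/
def start (x y : BitVec w) : Config w where
  pc := 0
  reg := fun i => if i = 0 then x else if i = 1 then y else 0
  mem := fun _ => 0
  out := []

/-- Started on the arguments `x`, `y`, the program halts after at most `T` steps, having written
exactly the list `out`. -/
def OutputsWithin (P : Program) (I : List (BitVec w)) (orc : BitVec w → Bool) (x y : BitVec w)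
    (T : ℕ) (out : List (BitVec w)) : Prop :=
  ∃ k ≤ T, ((step P I orc)^[k] (start x y)).current P = .halt ∧
    ((step P I orc)^[k] (start x y)).out = out

variable {n : ℕ} {α : Type u} [LinearOrder α]

/-- The oracle that tests `A[k] ≥ t`; it rejects words that are not indices of `A`. -/
def thresholdOracle (A : Fin n → α) (t : α) (k : BitVec w) : Bool :=
  if h : k.toNat < n then decide (t ≤ A ⟨k.toNat, h⟩) else false

/-- The set `{l ≤ k ≤ r ∣ A[k] ≥ t}`. -/
def answer (A : Fin n → α) (l r : Fin n) (t : α) : Finset (Fin n) :=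
  (Finset.Icc l r).filter fun k => t ≤ A k

/-- `q` solves range maximum queries on `A`: for `x ≤ y`, `q x y` is an index of a maximum of
`A[x], …, A[y]`. -/
def IsRMQ (A : Fin n → α) (q : Fin n → Fin n → Fin n) : Prop :=
  ∀ x y, x ≤ y → q x y ∈ Finset.Icc x y ∧ ∀ k ∈ Finset.Icc x y, A k ≤ A (q x y)

/-- `RangeRun A q t x y ans c`: the recursive procedure `range(x, y)` with threshold `t`
terminates, collects the set `ans`, and makes `c` calls of `range` in all, itself included.
The procedure returns at once if `x > y`; otherwise it computes `id = q x y`, and if `A[id] ≥ t`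
it adds `id` to the set and calls `range(x, id - 1)` and `range(id + 1, y)`. -/
inductive RangeRun (A : Fin n → α) (q : Fin n → Fin n → Fin n) (t : α) :
    ℤ → ℤ → Finset (Fin n) → ℕ → Prop
  | empty {x y : ℤ} : y < x → RangeRun A q t x y ∅ 1
  | reject {x y : Fin n} : x ≤ y → ¬ t ≤ A (q x y) →
      RangeRun A q t (x : ℕ) (y : ℕ) ∅ 1
  | split {x y : Fin n} {ans₁ ans₂ : Finset (Fin n)} {c₁ c₂ : ℕ} : x ≤ y → t ≤ A (q x y) →
      RangeRun A q t (x : ℕ) ((q x y : ℕ) - 1) ans₁ c₁ →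
      RangeRun A q t ((q x y : ℕ) + 1) (y : ℕ) ans₂ c₂ →
      RangeRun A q t (x : ℕ) (y : ℕ) (insert (q x y) (ans₁ ∪ ans₂)) (1 + c₁ + c₂)

end RangeReport

/-! For (b), the calls of `range` form a binary tree: a call that reports an index has two children
and every other call is a leaf, which gives the bound on their number. A rejected maximum rules out
its whole range (`RangeRun.correct`).

For (a), the program runs a recursion of this kind as a loop. It cannot compare entries of the
sequence, but it does not need a true maximum: any accepted index of the current range will do. The
range is covered by pieces for which the directory supplies at most six candidates in all, such that
every entry of the range is bounded by the entry at some candidate. Acceptance is upward closed, so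
the range contains an accepted index exactly if some candidate is accepted (`tryIndex_wp`,
`searches_searchRange`).

Let L be the integer part of log₂ n, let blocks have b = ⌊L/5⌋ entries and superblocks b blocks.
Inside a block, and among the block maxima of a superblock, the answer to a maximum query depends
only on the shape of a Cartesian tree. There are at most 4^b shapes, so one table of 4^b · b² words
serves both levels. Runs of whole superblocks are covered by two overlapping windows of a sparse
table. All this takes O(n/b) words, hence O(n) bits, since w = O(log n) (`exists_directory`,
`directorySize_bound`). If L < 64, no data is stored and the range is scanned; its length is then
bounded by a constant.

The pending right parts of the recursion are kept in working memory at the found indices, and k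
reported indices need 2k + 1 rounds (`loopWp_range`, `loopWp_search`). Each round is loop-free code,
verified over the natural numbers with overflow conditions and compiled to the machine; its cost is
at most the length of the code (`Code.asm_correct`). -/

namespace RangeReport

/-! ### A loop-free language over the natural numbers, its compilation and its weakest
preconditions. -/

/-- The arithmetic operations available in expressions. -/
inductive ArithOp
  | add | sub | mul | div | mod

/-- The machine operation that carries out an arithmetic operation. -/
def ArithOp.toBinOp : ArithOp → BinOp
  | .add => .add
  | .sub => .sub
  | .mul => .mul
  | .div => .div
  | .mod => .mod

/-- The arithmetic operation on natural numbers. -/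
def ArithOp.eval : ArithOp → ℕ → ℕ → ℕ
  | .add, x, y => x + y
  | .sub, x, y => x - y
  | .mul, x, y => x * y
  | .div, x, y => x / y
  | .mod, x, y => x % y

/-- The operation can be carried out on `w`-bit words without overflow. -/
def ArithOp.Fits (w : ℕ) : ArithOp → ℕ → ℕ → Prop
  | .add, x, y => x + y < 2 ^ w
  | .sub, x, y => y ≤ x
  | .mul, x, y => x * y < 2 ^ w
  | .div, _, _ => True
  | .mod, _, _ => True

/-- Expressions over registers, the read-only data structure and the working memory. -/
inductive Expr
  | reg (i : ℕ)
  | const (c : ℕ)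
  | arith (o : ArithOp) (a b : Expr)
  | look (a : Expr)
  | read (a : Expr)

instance : Add Expr := ⟨.arith .add⟩
instance : Sub Expr := ⟨.arith .sub⟩
instance : Mul Expr := ⟨.arith .mul⟩
instance : Div Expr := ⟨.arith .div⟩
instance : Mod Expr := ⟨.arith .mod⟩

/-- Machine states over the natural numbers. -/
@[ext] structure Store where
  reg : ℕ → ℕ
  mem : ℕ → ℕ
  out : List ℕ

/-- Assign a value to a register. -/
def Store.set (σ : Store) (d v : ℕ) : Store := { σ with reg := Function.update σ.reg d v }

/-- The value of an expression; `g` gives the contents of the data structure. -/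
def Expr.val (g : ℕ → ℕ) (σ : Store) : Expr → ℕ
  | reg i => σ.reg i
  | const c => c
  | arith o a b => o.eval (a.val g σ) (b.val g σ)
  | look a => g (a.val g σ)
  | read a => σ.mem (a.val g σ)

/-- No overflow occurs in the evaluation of an expression. -/
def Expr.Fits (w : ℕ) (g : ℕ → ℕ) (σ : Store) : Expr → Prop
  | reg _ => True
  | const c => c < 2 ^ w
  | arith o a b => a.Fits w g σ ∧ b.Fits w g σ ∧ o.Fits w (a.val g σ) (b.val g σ)
  | look a => a.Fits w g σ
  | read a => a.Fits w g σ

/-- The expression mentions only registers below `N`. -/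
def Expr.Within (N : ℕ) : Expr → Prop
  | reg i => i < N
  | const _ => True
  | arith _ a b => a.Within N ∧ b.Within N
  | look a => a.Within N
  | read a => a.Within N

/-- Code that evaluates an expression into register `t`, using no register below `t`. -/
def Expr.asm : Expr → ℕ → List Instr
  | reg i, t => [.move t i]
  | const c, t => [.const t c]
  | arith o a b, t => a.asm t ++ b.asm (t + 1) ++ [.bin o.toBinOp t t (t + 1)]
  | look a, t => a.asm t ++ [.look t t]
  | read a, t => a.asm t ++ [.load t t]

/-- Loop-free programs. -/
inductive Code
  | skip
  | set (d : ℕ) (a : Expr)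
  | ask (d : ℕ) (a : Expr)
  | emit (a : Expr)
  | write (a b : Expr)
  | seq (c₁ c₂ : Code)
  | ifLt (a b : Expr) (c₁ c₂ : Code)

/-- All registers in the program are below `N`. -/
def Code.Within (N : ℕ) : Code → Prop
  | skip => True
  | set d a => d < N ∧ a.Within N
  | ask d a => d < N ∧ a.Within N
  | emit a => a.Within N
  | write a b => a.Within N ∧ b.Within N
  | seq c₁ c₂ => c₁.Within N ∧ c₂.Within N
  | ifLt a b c₁ c₂ => a.Within N ∧ b.Within N ∧ c₁.Within N ∧ c₂.Within N

/-- The machine code, placed at position `p`; registers from `N` on are used as temporaries. -/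
def Code.asm (N : ℕ) : Code → ℕ → List Instr
  | skip, _ => []
  | set d a, _ => a.asm N ++ [.move d N]
  | ask d a, _ => a.asm N ++ [.ask d N]
  | emit a, _ => a.asm N ++ [.emit N]
  | write a b, _ => a.asm N ++ b.asm (N + 1) ++ [.store N (N + 1)]
  | seq c₁ c₂, p => c₁.asm N p ++ c₂.asm N (p + (c₁.asm N p).length)
  | ifLt a b c₁ c₂, p =>
      let test := a.asm N ++ b.asm (N + 1)
      let p₂ := p + test.length + 1
      let p₁ := p₂ + (c₂.asm N p₂).length + 1
      test ++ [.jumpLt N (N + 1) p₁] ++ c₂.asm N p₂ ++ [.jump (p₁ + (c₁.asm N p₁).length)] ++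
        c₁.asm N p₁

/-- The weakest precondition of a loop-free program for the postcondition `Q`. -/
def Code.wp (w : ℕ) (g : ℕ → ℕ) (accept : ℕ → Bool) : Code → (Store → Prop) → Store → Prop
  | skip, Q, σ => Q σ
  | set d a, Q, σ => a.Fits w g σ ∧ Q (σ.set d (a.val g σ))
  | ask d a, Q, σ => a.Fits w g σ ∧ Q (σ.set d (if accept (a.val g σ) then 1 else 0))
  | emit a, Q, σ => a.Fits w g σ ∧ Q { σ with out := σ.out ++ [a.val g σ] }
  | write a b, Q, σ => a.Fits w g σ ∧ b.Fits w g σ ∧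
      Q { σ with mem := Function.update σ.mem (a.val g σ) (b.val g σ) }
  | seq c₁ c₂, Q, σ => c₁.wp w g accept (c₂.wp w g accept Q) σ
  | ifLt a b c₁ c₂, Q, σ => a.Fits w g σ ∧ b.Fits w g σ ∧
      (a.val g σ < b.val g σ → c₁.wp w g accept Q σ) ∧
      (¬ a.val g σ < b.val g σ → c₂.wp w g accept Q σ)

theorem Code.wp_mono {w : ℕ} {g : ℕ → ℕ} {accept : ℕ → Bool} (c : Code) {Q Q' : Store → Prop}
    (h : ∀ σ, Q σ → Q' σ) : ∀ {σ}, c.wp w g accept Q σ → c.wp w g accept Q' σ := by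
  induction c generalizing Q Q' with
  | skip => exact fun {σ} => h σ
  | set d a => exact fun {σ} H => ⟨H.1, h _ H.2⟩
  | ask d a => exact fun {σ} H => ⟨H.1, h _ H.2⟩
  | emit a => exact fun {σ} H => ⟨H.1, h _ H.2⟩
  | write a b => exact fun {σ} H => ⟨H.1, H.2.1, h _ H.2.2⟩
  | seq c₁ c₂ h₁ h₂ => exact fun {σ} H => h₁ (fun σ => h₂ h) H
  | ifLt a b c₁ c₂ h₁ h₂ =>
    exact fun {σ} H => ⟨H.1, H.2.1, fun l => h₁ h (H.2.2.1 l), fun l => h₂ h (H.2.2.2 l)⟩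

/-- The list `L` occurs in the program `P` at position `p`. -/
def HasCode (P : Program) (p : ℕ) (L : List Instr) : Prop :=
  ∃ pre post, P = pre ++ L ++ post ∧ pre.length = p

theorem HasCode.append {P : Program} {p : ℕ} {L M : List Instr} (h : HasCode P p (L ++ M)) :
    HasCode P p L ∧ HasCode P (p + L.length) M := by
  obtain ⟨pre, post, rfl, rfl⟩ := h
  exact ⟨⟨pre, M ++ post, by simp, rfl⟩, ⟨pre ++ L, post, by simp, by simp⟩⟩

theorem HasCode.current {w : ℕ} {P : Program} {p : ℕ} {i : Instr} (h : HasCode P p [i])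
    {s : Config w} (hs : s.pc = p) : s.current P = i := by
  obtain ⟨pre, post, rfl, rfl⟩ := h
  simp [Config.current, hs]

/-! ### The compiled code simulates the semantics over the natural numbers. -/

section Simulation

variable {w : ℕ} {P : Program} {I : List (BitVec w)} {orc : BitVec w → Bool}

/-- The machine gets from `s` to `s'` in at most `T` steps. -/
def Reaches (P : Program) (I : List (BitVec w)) (orc : BitVec w → Bool) (T : ℕ)
    (s s' : Config w) : Prop :=
  ∃ k ≤ T, (step P I orc)^[k] s = s'

theorem Reaches.refl (s : Config w) (T : ℕ) : Reaches P I orc T s s := ⟨0, by simp, rfl⟩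

theorem Reaches.trans {T₁ T₂ T : ℕ} {s₁ s₂ s₃ : Config w} (h₁ : Reaches P I orc T₁ s₁ s₂)
    (h₂ : Reaches P I orc T₂ s₂ s₃) (hT : T₁ + T₂ ≤ T) : Reaches P I orc T s₁ s₃ := by
  obtain ⟨k₁, hk₁, rfl⟩ := h₁
  obtain ⟨k₂, hk₂, rfl⟩ := h₂
  exact ⟨k₂ + k₁, by omega, Function.iterate_add_apply ..⟩

theorem Reaches.single {p : ℕ} {i : Instr} (h : HasCode P p [i]) {s : Config w} (hs : s.pc = p) :
    Reaches P I orc 1 s (i.exec I orc s) :=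
  ⟨1, le_rfl, by simp [step, h.current hs]⟩

/-- The machine configuration `s` agrees with the state `σ` on the registers below `N`, on the
memory and on the output. -/
structure Represents (N : ℕ) (s : Config w) (σ : Store) : Prop where
  reg : ∀ i < N, (s.reg i).toNat = σ.reg i
  mem : ∀ v : BitVec w, (s.mem v).toNat = σ.mem v.toNat
  out : s.out.map BitVec.toNat = σ.out

theorem Represents.keep {N t : ℕ} {s s' : Config w} {σ : Store} (hs : Represents N s σ)
    (ht : N ≤ t) (hm : s'.mem = s.mem) (ho : s'.out = s.out) (hr : ∀ i < t, s'.reg i = s.reg i) :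
    Represents N s' σ :=
  ⟨fun i hi => by rw [hr i (by omega), hs.reg i hi], fun v => by rw [hm, hs.mem],
    by rw [ho, hs.out]⟩

/-- Temporaries are used like a stack growing upwards from `t`, so the value of a left operand, held
in `t`, survives the evaluation of the right operand in `t + 1`. -/
theorem Expr.asm_correct {g : ℕ → ℕ} (hg : ∀ v : BitVec w, (I.getD v.toNat 0).toNat = g v.toNat)
    {N : ℕ} {σ : Store} (e : Expr) (he : e.Within N) (hf : e.Fits w g σ) :
    ∀ (t p : ℕ) (s : Config w), N ≤ t → Represents N s σ → s.pc = p → HasCode P p (e.asm t) →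
      ∃ s', Reaches P I orc (e.asm t).length s s' ∧ s'.pc = p + (e.asm t).length ∧
        s'.mem = s.mem ∧ s'.out = s.out ∧ (∀ i < t, s'.reg i = s.reg i) ∧
        (s'.reg t).toNat = e.val g σ := by
  induction e with
  | reg i =>
    intro t p s ht hs hp hc
    refine ⟨_, Reaches.single hc hp, by simp [Instr.exec, Config.setReg, hp, Expr.asm], rfl, rfl,
      fun j hj => ?_, ?_⟩
    · simp [Instr.exec, Config.setReg, hj.ne]
    · simpa [Instr.exec, Config.setReg, Expr.val] using hs.reg i he
  | const c =>
    intro t p s ht hs hp hc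
    refine ⟨_, Reaches.single hc hp, by simp [Instr.exec, Config.setReg, hp, Expr.asm], rfl, rfl,
      fun j hj => ?_, ?_⟩
    · simp [Instr.exec, Config.setReg, hj.ne]
    · simpa [Instr.exec, Config.setReg, Expr.val] using Nat.mod_eq_of_lt hf
  | arith o a b iha ihb =>
    intro t p s ht hs hp hc
    obtain ⟨hc, hc₃⟩ := HasCode.append hc
    obtain ⟨hc₁, hc₂⟩ := HasCode.append hc
    obtain ⟨s₁, r₁, p₁, m₁, o₁, k₁, v₁⟩ := iha he.1 hf.1 t p s ht hs hp hc₁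
    obtain ⟨s₂, r₂, p₂, m₂, o₂, k₂, v₂⟩ :=
      ihb he.2 hf.2.1 (t + 1) _ s₁ (by omega) (hs.keep ht m₁ o₁ k₁) p₁ hc₂
    refine ⟨_, (r₁.trans r₂ le_rfl).trans (Reaches.single hc₃ ?_) ?_, ?_, ?_, ?_, ?_, ?_⟩
    · simp [p₂, add_assoc]
    · simp [Expr.asm, add_assoc]
    · simp [Instr.exec, Config.setReg, p₂, Expr.asm, add_assoc]
    · simp [Instr.exec, Config.setReg, m₁, m₂]
    · simp [Instr.exec, Config.setReg, o₁, o₂]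
    · intro j hj
      simp [Instr.exec, Config.setReg, hj.ne, k₂ j (by omega), k₁ j hj]
    · have h1 : (s₂.reg t).toNat = a.val g σ := by rw [k₂ t (by omega), v₁]
      have hf := hf.2.2
      have la := (s₂.reg t).isLt
      rw [h1] at la
      cases o
      · simpa [Instr.exec, Config.setReg, ArithOp.toBinOp, BinOp.eval, h1, v₂, Expr.val,
          ArithOp.eval] using Nat.mod_eq_of_lt hf
      -- Here `Fits` says that the subtrahend is at most the minuend, so word subtraction does not
      -- wrap around.
      · simp only [Instr.exec, Config.setReg, ArithOp.toBinOp, BinOp.eval, Function.update_self,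
          Expr.val, ArithOp.eval]
        rw [BitVec.toNat_sub_of_le, h1, v₂]
        rw [BitVec.le_def, h1, v₂]
        exact hf
      · simpa [Instr.exec, Config.setReg, ArithOp.toBinOp, BinOp.eval, h1, v₂, Expr.val,
          ArithOp.eval] using Nat.mod_eq_of_lt hf
      · simp [Instr.exec, Config.setReg, ArithOp.toBinOp, BinOp.eval, h1, v₂, Expr.val,
          ArithOp.eval]
      · simp [Instr.exec, Config.setReg, ArithOp.toBinOp, BinOp.eval, h1, v₂, Expr.val,
          ArithOp.eval]
  | look a iha =>
    intro t p s ht hs hp hc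
    obtain ⟨hc₁, hc₂⟩ := HasCode.append hc
    obtain ⟨s₁, r₁, p₁, m₁, o₁, k₁, v₁⟩ := iha he hf t p s ht hs hp hc₁
    refine ⟨_, r₁.trans (Reaches.single hc₂ p₁) ?_, ?_, m₁, o₁, ?_, ?_⟩
    · simp [Expr.asm]
    · simp [Instr.exec, Config.setReg, p₁, Expr.asm, add_assoc]
    · intro j hj
      simp [Instr.exec, Config.setReg, hj.ne, k₁ j hj]
    · have := hg (s₁.reg t)
      rw [v₁] at this
      simpa [Instr.exec, Config.setReg, v₁, Expr.val] using this
  | read a iha =>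
    intro t p s ht hs hp hc
    obtain ⟨hc₁, hc₂⟩ := HasCode.append hc
    obtain ⟨s₁, r₁, p₁, m₁, o₁, k₁, v₁⟩ := iha he hf t p s ht hs hp hc₁
    refine ⟨_, r₁.trans (Reaches.single hc₂ p₁) ?_, ?_, m₁, o₁, ?_, ?_⟩
    · simp [Expr.asm]
    · simp [Instr.exec, Config.setReg, p₁, Expr.asm, add_assoc]
    · intro j hj
      simp [Instr.exec, Config.setReg, hj.ne, k₁ j hj]
    · have := hs.mem (s₁.reg t)
      rw [v₁, ← m₁] at this
      simpa [Instr.exec, Config.setReg, Expr.val] using this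

theorem Represents.setReg {N d : ℕ} {s : Config w} {σ : Store} (hs : Represents N s σ)
    {v : BitVec w} {x : ℕ} (hv : v.toNat = x) : Represents N (s.setReg d v) (σ.set d x) := by
  refine ⟨fun i hi => ?_, hs.mem, hs.out⟩
  by_cases h : i = d
  · subst h
    simp [Config.setReg, Store.set, hv]
  · simp [Config.setReg, Store.set, h, hs.reg i hi]

/-- All jumps go forward, so no instruction is executed twice and the length of the code bounds the
running time. This is what makes a round cost O(1). -/
theorem Code.asm_correct (hw : 0 < w) {g : ℕ → ℕ}
    (hg : ∀ v : BitVec w, (I.getD v.toNat 0).toNat = g v.toNat) {accept : ℕ → Bool}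
    (ho : ∀ v, orc v = accept v.toNat) {N : ℕ} (c : Code) (hc : c.Within N) :
    ∀ {Q : Store → Prop} {σ : Store} (p : ℕ) (s : Config w), c.wp w g accept Q σ →
      Represents N s σ → s.pc = p → HasCode P p (c.asm N p) →
      ∃ s' σ', Reaches P I orc (c.asm N p).length s s' ∧ s'.pc = p + (c.asm N p).length ∧
        Represents N s' σ' ∧ Q σ' := by
  induction c with
  | skip => exact fun p s H hs hp _ => ⟨s, _, Reaches.refl s _, by simpa [Code.asm], hs, H⟩
  | set d a =>
    intro Q σ p s H hs hp hcode
    obtain ⟨hc₁, hc₂⟩ := HasCode.append hcode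
    obtain ⟨s₁, r₁, p₁, m₁, o₁, k₁, v₁⟩ :=
      a.asm_correct (orc := orc) hg hc.2 H.1 N p s le_rfl hs hp hc₁
    refine ⟨_, _, r₁.trans (Reaches.single hc₂ p₁) (by simp [Code.asm]), ?_,
      (hs.keep le_rfl m₁ o₁ k₁).setReg v₁, H.2⟩
    simp [Instr.exec, Config.setReg, p₁, Code.asm, add_assoc]
  | ask d a =>
    intro Q σ p s H hs hp hcode
    obtain ⟨hc₁, hc₂⟩ := HasCode.append hcode
    obtain ⟨s₁, r₁, p₁, m₁, o₁, k₁, v₁⟩ :=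
      a.asm_correct (orc := orc) hg hc.2 H.1 N p s le_rfl hs hp hc₁
    refine ⟨_, _, r₁.trans (Reaches.single hc₂ p₁) (by simp [Code.asm]), ?_,
      (hs.keep le_rfl m₁ o₁ k₁).setReg ?_, H.2⟩
    · simp [Instr.exec, Config.setReg, p₁, Code.asm, add_assoc]
    · rw [ho, v₁]
      split <;> simp [Nat.mod_eq_of_lt (Nat.one_lt_two_pow hw.ne')]
  | emit a =>
    intro Q σ p s H hs hp hcode
    obtain ⟨hc₁, hc₂⟩ := HasCode.append hcode
    obtain ⟨s₁, r₁, p₁, m₁, o₁, k₁, v₁⟩ :=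
      a.asm_correct (orc := orc) hg hc H.1 N p s le_rfl hs hp hc₁
    have hs₁ := hs.keep le_rfl m₁ o₁ k₁
    refine ⟨_, { σ with out := σ.out ++ [a.val g σ] },
      r₁.trans (Reaches.single hc₂ p₁) (by simp [Code.asm]), ?_, ⟨hs₁.reg, hs₁.mem, ?_⟩, H.2⟩
    · simp [Instr.exec, p₁, Code.asm, add_assoc]
    · simp [Instr.exec, hs₁.out, v₁]
  | write a b =>
    intro Q σ p s H hs hp hcode
    obtain ⟨hcode, hc₃⟩ := HasCode.append hcode
    obtain ⟨hc₁, hc₂⟩ := HasCode.append hcode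
    obtain ⟨s₁, r₁, p₁, m₁, o₁, k₁, v₁⟩ :=
      a.asm_correct (orc := orc) hg hc.1 H.1 N p s le_rfl hs hp hc₁
    have hs₁ := hs.keep le_rfl m₁ o₁ k₁
    obtain ⟨s₂, r₂, p₂, m₂, o₂, k₂, v₂⟩ :=
      b.asm_correct (orc := orc) hg hc.2 H.2.1 (N + 1) _ s₁ (by omega) hs₁ p₁ hc₂
    have hs₂ := hs₁.keep (by omega) m₂ o₂ k₂
    refine ⟨_, { σ with mem := Function.update σ.mem (a.val g σ) (b.val g σ) },
      (r₁.trans r₂ le_rfl).trans (Reaches.single hc₃ ?_) (by simp [Code.asm, add_assoc]),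
      ?_, ⟨hs₂.reg, fun v => ?_, hs₂.out⟩, H.2.2⟩
    · simp [p₂, add_assoc]
    · simp [Instr.exec, p₂, Code.asm, add_assoc]
    · have h1 : (s₂.reg N).toNat = a.val g σ := by rw [k₂ N (by omega), v₁]
      by_cases hv : v = s₂.reg N
      · subst hv
        simp [Instr.exec, h1, v₂]
      · have : v.toNat ≠ a.val g σ := by
          rw [← h1]
          exact fun h => hv (BitVec.eq_of_toNat_eq h)
        simp [Instr.exec, hv, this, hs₂.mem v]
  | seq c₁ c₂ h₁ h₂ =>
    intro Q σ p s H hs hp hcode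
    obtain ⟨hc₁, hc₂⟩ := HasCode.append hcode
    obtain ⟨s₁, σ₁, r₁, p₁, hs₁, H₁⟩ := h₁ hc.1 p s H hs hp hc₁
    obtain ⟨s₂, σ₂, r₂, p₂, hs₂, H₂⟩ := h₂ hc.2 _ s₁ H₁ hs₁ p₁ hc₂
    exact ⟨s₂, σ₂, r₁.trans r₂ (by simp [Code.asm]), by simp [p₂, Code.asm, add_assoc], hs₂, H₂⟩
  | ifLt a b c₁ c₂ h₁ h₂ =>
    intro Q σ p s H hs hp hcode
    obtain ⟨q₂, hq₂⟩ : ∃ q, q = p + (a.asm N ++ b.asm (N + 1)).length + 1 := ⟨_, rfl⟩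
    obtain ⟨q₁, hq₁⟩ : ∃ q, q = q₂ + (c₂.asm N q₂).length + 1 := ⟨_, rfl⟩
    have hasm : (Code.ifLt a b c₁ c₂).asm N p = a.asm N ++ b.asm (N + 1) ++
        [.jumpLt N (N + 1) q₁] ++ c₂.asm N q₂ ++ [.jump (q₁ + (c₁.asm N q₁).length)] ++
        c₁.asm N q₁ := by
      subst hq₁ hq₂
      rfl
    rw [hasm] at hcode ⊢
    simp only [List.length_append, List.length_singleton] at hq₂ ⊢
    obtain ⟨hcode, hc₅⟩ := HasCode.append hcode
    obtain ⟨hcode, hc₄⟩ := HasCode.append hcode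
    obtain ⟨hcode, hc₃⟩ := HasCode.append hcode
    obtain ⟨hcode, hcj⟩ := HasCode.append hcode
    obtain ⟨hc₁, hc₂⟩ := HasCode.append hcode
    simp only [List.length_append, List.length_singleton] at hc₅ hc₄ hc₃ hcj
    rw [show p + ((a.asm N).length + (b.asm (N + 1)).length + 1 + (c₂.asm N q₂).length + 1) = q₁
      by omega] at hc₅
    rw [show p + ((a.asm N).length + (b.asm (N + 1)).length + 1) = q₂ by omega] at hc₃
    obtain ⟨s₁, r₁, p₁, m₁, o₁, k₁, v₁⟩ :=
      a.asm_correct (orc := orc) hg hc.1 H.1 N p s le_rfl hs hp hc₁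
    have hs₁ := hs.keep le_rfl m₁ o₁ k₁
    obtain ⟨s₂, r₂, p₂, m₂, o₂, k₂, v₂⟩ :=
      b.asm_correct (orc := orc) hg hc.2.1 H.2.1 (N + 1) _ s₁ (by omega) hs₁ p₁ hc₂
    have hs₂ := hs₁.keep (by omega) m₂ o₂ k₂
    have h1 : (s₂.reg N).toNat = a.val g σ := by rw [k₂ N (by omega), v₁]
    have r₃ := (r₁.trans r₂ le_rfl).trans
      (Reaches.single (I := I) (orc := orc) hcj (by omega)) le_rfl
    obtain ⟨s₃, hs₃⟩ : ∃ s', s' = (Instr.jumpLt N (N + 1) q₁).exec I orc s₂ := ⟨_, rfl⟩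
    have hr₃ : Represents N s₃ σ := by
      rw [hs₃]
      exact ⟨hs₂.reg, hs₂.mem, hs₂.out⟩
    rw [← hs₃] at r₃
    by_cases hlt : a.val g σ < b.val g σ
    · have hl : s₂.reg N < s₂.reg (N + 1) := by rwa [BitVec.lt_def, h1, v₂]
      obtain ⟨s₄, σ₄, r₄, p₄, hs₄, H₄⟩ := h₁ hc.2.2.1 q₁ s₃ (H.2.2.1 hlt) hr₃
        (by simp [hs₃, Instr.exec, hl]) hc₅
      exact ⟨s₄, σ₄, r₃.trans r₄ (by omega), by omega, hs₄, H₄⟩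
    · have hl : ¬ s₂.reg N < s₂.reg (N + 1) := by rwa [BitVec.lt_def, h1, v₂]
      obtain ⟨s₄, σ₄, r₄, p₄, hs₄, H₄⟩ := h₂ hc.2.2.2 q₂ s₃ (H.2.2.2 hlt) hr₃
        (by simp only [hs₃, Instr.exec, if_neg hl]; omega) hc₃
      refine ⟨_, σ₄, (r₃.trans r₄ le_rfl).trans (Reaches.single hc₄ (by omega)) (by omega), ?_,
        ⟨hs₄.reg, hs₄.mem, hs₄.out⟩, H₄⟩
      simp only [Instr.exec]
      omega

end Simulation

/-! ### The single loop around loop-free code. -/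

/-- `m` rounds of the loop `repeat c until R[d] ≠ 0` suffice to reach the postcondition `Q`. -/
def Code.loopWp (w : ℕ) (g : ℕ → ℕ) (accept : ℕ → Bool) (c : Code) (d : ℕ) (Q : Store → Prop) :
    ℕ → Store → Prop
  | 0, _ => False
  | m + 1, σ => c.wp w g accept
      (fun σ' => (σ'.reg d = 0 ∧ c.loopWp w g accept d Q m σ') ∨ (σ'.reg d ≠ 0 ∧ Q σ')) σ

/-- The program `c₀; repeat c until R[d] ≠ 0`. -/
def loopProgram (N : ℕ) (c₀ c : Code) (d : ℕ) : Program :=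
  let p := (c₀.asm N 0).length
  c₀.asm N 0 ++ (c.asm N p ++ [.const N 1, .jumpLt d N p])

theorem Code.loopWp_reaches {w : ℕ} (hw : 0 < w) {P : Program} {I : List (BitVec w)}
    {orc : BitVec w → Bool} {g : ℕ → ℕ}
    (hg : ∀ v : BitVec w, (I.getD v.toNat 0).toNat = g v.toNat) {accept : ℕ → Bool}
    (ho : ∀ v, orc v = accept v.toNat) {N d p : ℕ} (hd : d < N) {c : Code} (hc : c.Within N)
    {Q : Store → Prop} (hP : HasCode P p (c.asm N p ++ [.const N 1, .jumpLt d N p])) (m : ℕ) :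
    ∀ (s : Config w) (σ : Store), c.loopWp w g accept d Q m σ → Represents N s σ → s.pc = p →
      ∃ s' σ', Reaches P I orc (m * ((c.asm N p).length + 2)) s s' ∧
        s'.pc = p + (c.asm N p).length + 2 ∧ Represents N s' σ' ∧ Q σ' := by
  induction m with
  | zero => exact fun s σ H => H.elim
  | succ m ih =>
    intro s σ H hs hp
    obtain ⟨hc₁, hc₂⟩ := HasCode.append hP
    obtain ⟨hc₂, hc₃⟩ := HasCode.append (L := [_]) (M := [_]) hc₂
    obtain ⟨s₁, σ₁, r₁, p₁, hs₁, H₁⟩ := c.asm_correct hw hg ho hc p s H hs hp hc₁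
    have hs₂ : Represents N ((Instr.const N 1).exec I orc s₁) σ₁ :=
      hs₁.keep le_rfl rfl rfl fun i hi => by simp [Instr.exec, Config.setReg, hi.ne]
    have r₂ := (r₁.trans (Reaches.single (I := I) (orc := orc) hc₂ p₁) le_rfl).trans
      (Reaches.single (I := I) (orc := orc) hc₃ (by simp [Instr.exec, Config.setReg, p₁])) le_rfl
    have hpc : ((Instr.const N 1).exec I orc s₁).pc = p + (c.asm N p).length + 1 := by
      simp [Instr.exec, Config.setReg, p₁]
    have hone : (((Instr.const N 1).exec I orc s₁).reg N).toNat = 1 := by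
      simp [Instr.exec, Config.setReg, Nat.mod_eq_of_lt (Nat.one_lt_two_pow hw.ne')]
    generalize (Instr.const N 1).exec I orc s₁ = s₂ at hs₂ r₂ hpc hone
    -- The backward jump compares with the constant 1, so it is a test for zero.
    have key : s₂.reg d < s₂.reg N ↔ σ₁.reg d = 0 := by
      rw [BitVec.lt_def, hs₂.reg d hd, hone, Nat.lt_one_iff]
    rcases H₁ with ⟨hz, H₁⟩ | ⟨hz, H₁⟩
    · obtain ⟨s₃, σ₃, r₃, p₃, hs₃, H₃⟩ := ih _ σ₁ H₁
        (⟨hs₂.reg, hs₂.mem, hs₂.out⟩ : Represents N ((Instr.jumpLt d N p).exec I orc s₂) σ₁)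
        (by simp only [Instr.exec]; rw [if_pos (key.2 hz)])
      exact ⟨s₃, σ₃, r₂.trans r₃ (by rw [add_mul]; omega), p₃, hs₃, H₃⟩
    · refine ⟨_, σ₁, r₂.trans (Reaches.refl _ 0) (by rw [add_mul]; omega), ?_,
        ⟨hs₂.reg, hs₂.mem, hs₂.out⟩, H₁⟩
      simp only [Instr.exec]
      rw [if_neg (mt key.1 hz)]
      omega

/-- The initial state of a query. -/
def Store.start (x y : ℕ) : Store where
  reg := fun i => if i = 0 then x else if i = 1 then y else 0
  mem := fun _ => 0
  out := []

theorem loopProgram_outputs {w : ℕ} (hw : 0 < w) {I : List (BitVec w)}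
    {orc : BitVec w → Bool} {g : ℕ → ℕ}
    (hg : ∀ v : BitVec w, (I.getD v.toNat 0).toNat = g v.toNat) {accept : ℕ → Bool}
    (ho : ∀ v, orc v = accept v.toNat) {N d : ℕ} (hd : d < N) {c₀ c : Code} (hc₀ : c₀.Within N)
    (hc : c.Within N) {Q : Store → Prop} {m x y T : ℕ} (hx : x < 2 ^ w) (hy : y < 2 ^ w)
    (h : c₀.wp w g accept (c.loopWp w g accept d Q m) (Store.start x y))
    (hT : (loopProgram N c₀ c d).length * (m + 1) ≤ T) :
    ∃ out, OutputsWithin (loopProgram N c₀ c d) I orc (BitVec.ofNat w x) (BitVec.ofNat w y) T out ∧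
      ∃ σ, Q σ ∧ out.map BitVec.toNat = σ.out := by
  have hs : Represents N (start (BitVec.ofNat w x) (BitVec.ofNat w y)) (Store.start x y) := by
    refine ⟨fun i _ => ?_, fun v => by simp [start, Store.start], rfl⟩
    simp only [start, Store.start]
    split_ifs <;> simp [Nat.mod_eq_of_lt, hx, hy]
  have hP : HasCode (loopProgram N c₀ c d) 0 (loopProgram N c₀ c d) := ⟨[], [], by simp, rfl⟩
  obtain ⟨hP₁, hP₂⟩ := HasCode.append (L := c₀.asm N 0) hP
  rw [zero_add] at hP₂
  obtain ⟨s₁, σ₁, r₁, p₁, hs₁, H₁⟩ := c₀.asm_correct hw hg ho hc₀ 0 _ h hs rfl hP₁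
  obtain ⟨s₂, σ₂, r₂, p₂, hs₂, H₂⟩ :=
    Code.loopWp_reaches hw hg ho hd hc hP₂ m s₁ σ₁ H₁ hs₁ (by simpa using p₁)
  have hl : (loopProgram N c₀ c d).length =
      (c₀.asm N 0).length + ((c.asm N (c₀.asm N 0).length).length + 2) := by
    simp [loopProgram]
  obtain ⟨k, hk, hk'⟩ := r₁.trans r₂ (T := T) (le_trans (by rw [hl]; nlinarith) hT)
  refine ⟨s₂.out, ⟨k, hk, ?_, by rw [hk']⟩, σ₂, H₂, hs₂.out⟩
  -- The machine stops by running off the end of the program, where the next instruction is `halt`.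
  rw [hk', Config.current, List.getD_eq_default]
  omega

/-! ### Evaluation rules for expressions. -/

section ExprLemmas

variable (w : ℕ) (g : ℕ → ℕ) (σ : Store) (N : ℕ) (a b : Expr)

@[simp] theorem Expr.val_add : (a + b).val g σ = a.val g σ + b.val g σ := rfl
@[simp] theorem Expr.val_sub : (a - b).val g σ = a.val g σ - b.val g σ := rfl
@[simp] theorem Expr.val_mul : (a * b).val g σ = a.val g σ * b.val g σ := rfl
@[simp] theorem Expr.val_div : (a / b).val g σ = a.val g σ / b.val g σ := rfl
@[simp] theorem Expr.val_mod : (a % b).val g σ = a.val g σ % b.val g σ := rfl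
@[simp] theorem Expr.val_reg (i : ℕ) : (Expr.reg i).val g σ = σ.reg i := rfl
@[simp] theorem Expr.val_const (c : ℕ) : (Expr.const c).val g σ = c := rfl
@[simp] theorem Expr.val_look : (Expr.look a).val g σ = g (a.val g σ) := rfl
@[simp] theorem Expr.val_read : (Expr.read a).val g σ = σ.mem (a.val g σ) := rfl

@[simp] theorem Expr.fits_add : (a + b).Fits w g σ ↔
    a.Fits w g σ ∧ b.Fits w g σ ∧ a.val g σ + b.val g σ < 2 ^ w := Iff.rfl
@[simp] theorem Expr.fits_sub : (a - b).Fits w g σ ↔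
    a.Fits w g σ ∧ b.Fits w g σ ∧ b.val g σ ≤ a.val g σ := Iff.rfl
@[simp] theorem Expr.fits_mul : (a * b).Fits w g σ ↔
    a.Fits w g σ ∧ b.Fits w g σ ∧ a.val g σ * b.val g σ < 2 ^ w := Iff.rfl
@[simp] theorem Expr.fits_div : (a / b).Fits w g σ ↔ a.Fits w g σ ∧ b.Fits w g σ :=
  ⟨fun h => ⟨h.1, h.2.1⟩, fun h => ⟨h.1, h.2, trivial⟩⟩
@[simp] theorem Expr.fits_mod : (a % b).Fits w g σ ↔ a.Fits w g σ ∧ b.Fits w g σ :=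
  ⟨fun h => ⟨h.1, h.2.1⟩, fun h => ⟨h.1, h.2, trivial⟩⟩
@[simp] theorem Expr.fits_reg (i : ℕ) : (Expr.reg i).Fits w g σ := trivial
@[simp] theorem Expr.fits_const (c : ℕ) : (Expr.const c).Fits w g σ ↔ c < 2 ^ w := Iff.rfl
@[simp] theorem Expr.fits_look : (Expr.look a).Fits w g σ ↔ a.Fits w g σ := Iff.rfl

@[simp] theorem Expr.within_add : (a + b).Within N ↔ a.Within N ∧ b.Within N := Iff.rfl
@[simp] theorem Expr.within_sub : (a - b).Within N ↔ a.Within N ∧ b.Within N := Iff.rfl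
@[simp] theorem Expr.within_mul : (a * b).Within N ↔ a.Within N ∧ b.Within N := Iff.rfl
@[simp] theorem Expr.within_div : (a / b).Within N ↔ a.Within N ∧ b.Within N := Iff.rfl
@[simp] theorem Expr.within_mod : (a % b).Within N ↔ a.Within N ∧ b.Within N := Iff.rfl

end ExprLemmas

/-! ### The set of accepted indices of a range. -/

/-- The indices in `[x, e)` that the oracle accepts. -/
def hits (accept : ℕ → Bool) (x e : ℕ) : Finset ℕ := (Finset.Ico x e).filter fun k => accept k

@[simp] theorem mem_hits {accept : ℕ → Bool} {x e k : ℕ} :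
    k ∈ hits accept x e ↔ (x ≤ k ∧ k < e) ∧ accept k = true := by
  simp [hits]

theorem hits_split {accept : ℕ → Bool} {x e i : ℕ} (hi : i ∈ hits accept x e) :
    hits accept x e = insert i (hits accept x i ∪ hits accept (i + 1) e) := by
  rw [mem_hits] at hi
  ext k
  simp only [mem_hits, Finset.mem_insert, Finset.mem_union]
  constructor
  · rintro ⟨h, hk⟩
    rcases lt_trichotomy k i with h' | h' | h'
    · exact Or.inr (Or.inl ⟨⟨h.1, h'⟩, hk⟩)
    · exact Or.inl h'
    · exact Or.inr (Or.inr ⟨⟨h', h.2⟩, hk⟩)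
  · rintro (rfl | ⟨h, hk⟩ | ⟨h, hk⟩)
    · exact hi
    · exact ⟨⟨h.1, by omega⟩, hk⟩
    · exact ⟨⟨by omega, h.2⟩, hk⟩

theorem card_hits_split {accept : ℕ → Bool} {x e i : ℕ} (hi : i ∈ hits accept x e) :
    (hits accept x e).card = (hits accept x i).card + (hits accept (i + 1) e).card + 1 := by
  rw [hits_split hi, Finset.card_insert_of_notMem, Finset.card_union_of_disjoint]
  · rw [Finset.disjoint_left]
    intro k h₁ h₂
    rw [mem_hits] at h₁ h₂
    omega
  · simp

/-! ### The reporting loop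

Register `0` holds the left end of the current range, register `1` its right end (exclusive),
register `2` the right end of the query (exclusive), register `3` is set when everything has been
reported, and a search leaves in register `4` whether it was successful and in register `5` what
it found.  When an index `i` in the current range `[x, e)` is found, the loop goes on with `[x, i)`
and stores `e` at the address `i`, to continue later with `[i + 1, e)`. -/

/-- One round in which a single index is examined. -/
def scanStep : Code :=
  .ifLt (.reg 0) (.reg 1)
    (.seq (.ask 4 (.reg 0))
      (.seq (.ifLt (.const 0) (.reg 4) (.emit (.reg 0)) .skip) (.set 0 (.reg 0 + .const 1))))
    (.set 3 (.const 1))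

/-- One round in which `search` looks for an accepted index in the current range. -/
def searchStep (search : Code) : Code :=
  .seq (.set 4 (.const 0))
    (.seq (.ifLt (.reg 0) (.reg 1) search .skip)
      (.ifLt (.const 0) (.reg 4)
        (.seq (.emit (.reg 5)) (.seq (.write (.reg 5) (.reg 1)) (.set 1 (.reg 5))))
        (.ifLt (.reg 1) (.reg 2)
          (.seq (.set 0 (.reg 1 + .const 1)) (.set 1 (.read (.reg 1))))
          (.set 3 (.const 1)))))

/-- One round of the reporting loop.  The first word of the data structure is zero if the
indices are to be examined one by one. -/
def reportStep (search : Code) : Code :=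
  .ifLt (.const 0) (.look (.const 0)) (searchStep search) scanStep

/-- The initialization of the reporting loop. -/
def reportInit : Code :=
  .seq (.set 1 (.reg 1 + .const 1)) (.set 2 (.reg 1))

/-- The state in which the range `[x, e)` of the query with right end `R` is to be treated. -/
structure AtRange (σ : Store) (x e R : ℕ) : Prop where
  left : σ.reg 0 = x
  right : σ.reg 1 = e
  last : σ.reg 2 = R
  running : σ.reg 3 = 0

section Loop

variable {w : ℕ} {g : ℕ → ℕ} {accept : ℕ → Bool} {search : Code} {n : ℕ}

/-- `σ'` results from `σ` by a search for an accepted index among those in `[x, e)` that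
satisfy `p`: either some accepted index of `[x, e)` has been found, or none that satisfies `p` is
accepted. -/
def Searched (accept : ℕ → Bool) (p : ℕ → Prop) (σ σ' : Store) : Prop :=
  ∃ f i, σ' = (σ.set 4 f).set 5 i ∧
    ((f = 0 ∧ ∀ k, p k → accept k = false) ∨
      (f = 1 ∧ i ∈ hits accept (σ.reg 0) (σ.reg 1)))

/-- `search` finds an accepted index in the current range if there is one. -/
def Searches (w : ℕ) (g : ℕ → ℕ) (accept : ℕ → Bool) (n : ℕ) (search : Code) : Prop :=
  ∀ σ : Store, σ.reg 0 < σ.reg 1 → σ.reg 1 ≤ n → σ.reg 4 = 0 →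
    search.wp w g accept (Searched accept (fun k => σ.reg 0 ≤ k ∧ k < σ.reg 1) σ) σ

/-- A round has three outcomes, each with its own continuation: an index is found and the range
shrinks to its left part, the range is exhausted and a pending right part is resumed, or nothing is
pending. -/
theorem searchStep_wp (hs : Searches w g accept n search) (hw : 0 < w) (hn : n < 2 ^ w)
    {σ : Store} {x e R : ℕ} (hσ : AtRange σ x e R) (heR : e ≤ R) (hR : R ≤ n)
    (Q : Store → Prop)
    (hfound : ∀ i ∈ hits accept x e, ∀ σ' : Store, AtRange σ' x i R →
      σ'.mem = Function.update σ.mem i e → σ'.out = σ.out ++ [i] → Q σ')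
    (hnext : hits accept x e = ∅ → e < R → ∀ σ' : Store, AtRange σ' (e + 1) (σ.mem e) R →
      σ'.mem = σ.mem → σ'.out = σ.out → Q σ')
    (hdone : hits accept x e = ∅ → e = R → ∀ σ' : Store, σ'.reg 3 ≠ 0 → σ'.out = σ.out → Q σ') :
    (searchStep search).wp w g accept Q σ := by
  have h0 : 0 < 2 ^ w := by positivity
  have h1 : 1 < 2 ^ w := Nat.one_lt_two_pow hw.ne'
  -- The second half of the round, shared by the cases where the search is executed and where it is
  -- skipped because the range is empty.
  have conclude : ∀ τ : Store, AtRange τ x e R → τ.mem = σ.mem → τ.out = σ.out →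
      ((τ.reg 4 = 0 ∧ hits accept x e = ∅) ∨ (τ.reg 4 = 1 ∧ τ.reg 5 ∈ hits accept x e)) →
      (Code.ifLt (.const 0) (.reg 4)
        (.seq (.emit (.reg 5)) (.seq (.write (.reg 5) (.reg 1)) (.set 1 (.reg 5))))
        (.ifLt (.reg 1) (.reg 2)
          (.seq (.set 0 (.reg 1 + .const 1)) (.set 1 (.read (.reg 1))))
          (.set 3 (.const 1)))).wp w g accept Q τ := by
    intro τ hτ hm ho H
    refine ⟨h0, trivial, fun hf => ?_, fun hf => ?_⟩
    · rcases H with ⟨H, -⟩ | ⟨-, hi⟩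
      · simp [H] at hf
      · refine ⟨trivial, trivial, trivial, trivial, hfound _ hi _ ?_ ?_ ?_⟩
        · constructor <;> simp [Store.set, hτ.left, hτ.last, hτ.running]
        · simp [Store.set, hτ.right, hm]
        · simp [Store.set, ho]
    · rcases H with ⟨-, hemp⟩ | ⟨H, -⟩
      · refine ⟨trivial, trivial, fun hlt => ?_, fun hlt => ?_⟩
        · simp only [Expr.val_reg, hτ.right, hτ.last] at hlt
          refine ⟨⟨trivial, h1, ?_⟩, trivial, hnext hemp hlt _ ?_ ?_ ?_⟩
          · show τ.reg 1 + 1 < 2 ^ w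
            rw [hτ.right]
            omega
          · constructor <;> simp [Store.set, hτ.right, hτ.last, hτ.running, hm]
          · simp [Store.set, hm]
          · simp [Store.set, ho]
        · simp only [Expr.val_reg, hτ.right, hτ.last] at hlt
          exact ⟨h1, hdone hemp (by omega) _ (by simp [Store.set]) ho⟩
      · simp [H] at hf
  refine ⟨h0, trivial, trivial, ?_, ?_⟩
  · intro hlt
    refine Code.wp_mono search ?_ (hs (σ.set 4 0) hlt ?_ rfl)
    · rintro _ ⟨f, i, rfl, H⟩
      have hx : ((σ.set 4 0).reg 0) = x := hσ.left
      have he : ((σ.set 4 0).reg 1) = e := hσ.right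
      rw [hx, he] at H
      refine conclude _ ?_ rfl rfl ?_
      · constructor <;> simp [Store.set, hσ.left, hσ.right, hσ.last, hσ.running]
      · rcases H with ⟨rfl, hk⟩ | ⟨rfl, hi⟩
        · refine Or.inl ⟨by simp [Store.set], ?_⟩
          ext k
          simp only [mem_hits, Finset.notMem_empty, iff_false]
          rintro ⟨h, h'⟩
          simp [hk k h] at h'
        · exact Or.inr ⟨by simp [Store.set], by simpa [Store.set] using hi⟩
    · have := hσ.right
      simp [Store.set]
      omega
  · intro hlt
    have hlt : ¬ x < e := by simpa [Store.set, hσ.left, hσ.right] using hlt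
    refine conclude _ ?_ rfl rfl (Or.inl ⟨by simp [Store.set], ?_⟩)
    · constructor <;> simp [Store.set, hσ.left, hσ.right, hσ.last, hσ.running]
    · ext k
      simp
      omega

/-- Each accepted index costs two rounds: one that finds it and one that later resumes the part to
its right. The continuation requires only memory at addresses from `e` on to be unchanged, because
all indices found in the range, hence all addresses written, lie below `e`. The left end may have
moved meanwhile, hence the new `x'`. -/
theorem loopWp_range (hs : Searches w g accept n search) (hw : 0 < w) (hg : 0 < g 0)
    (hn : n < 2 ^ w) {R : ℕ} (hR : R ≤ n) {Q : Store → Prop} (s : ℕ) :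
    ∀ {σ : Store} {x e : ℕ}, e - x ≤ s → AtRange σ x e R → e ≤ R → ∀ m,
      (∀ σ' x' L, hits accept x' e = ∅ → AtRange σ' x' e R → (∀ i, e ≤ i → σ'.mem i = σ.mem i) →
        σ'.out = σ.out ++ L → L.Nodup → L.toFinset = hits accept x e →
        (reportStep search).loopWp w g accept 3 Q m σ') →
      (reportStep search).loopWp w g accept 3 Q (m + 2 * (hits accept x e).card) σ := by
  have h0 : 0 < 2 ^ w := by positivity
  induction s with
  | zero =>
    intro σ x e hes hσ heR m H
    have hemp : hits accept x e = ∅ := by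
      ext k
      simp
      omega
    rw [hemp]
    exact H σ x [] hemp hσ (fun _ _ => rfl) (by simp) List.nodup_nil (by simp [hemp])
  | succ s ih =>
    intro σ x e hes hσ heR m H
    rcases (hits accept x e).eq_empty_or_nonempty with hemp | ⟨i, hi⟩
    · rw [hemp]
      exact H σ x [] hemp hσ (fun _ _ => rfl) (by simp) List.nodup_nil (by simp [hemp])
    obtain ⟨M, hM⟩ : ∃ M, m + 2 * (hits accept x e).card = M + 1 := by
      have := card_hits_split hi
      exact ⟨m + 2 * (hits accept x e).card - 1, by omega⟩
    rw [hM]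
    refine ⟨h0, h0, fun _ => ?_, fun h => absurd hg h⟩
    refine searchStep_wp hs hw hn hσ heR hR _ ?_ (fun h => absurd hi (by simp [h]))
      (fun h => absurd hi (by simp [h]))
    intro j hj σ₁ hσ₁ hm₁ ho₁
    refine Or.inl ⟨hσ₁.running, ?_⟩
    have hc := card_hits_split hj
    have hsplit := hits_split hj
    rw [mem_hits] at hj
    -- One round is already spent on finding `j`. The rest pays for the left part, one round that
    -- resumes, and the right part.
    have hM' : M = (m + 2 * (hits accept (j + 1) e).card + 1) + 2 * (hits accept x j).card := by
      omega
    rw [hM']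
    refine ih (by omega) hσ₁ (by omega) _ ?_
    intro σ₂ x₂ L₂ hemp₂ hσ₂ hm₂ ho₂ hnd₂ hL₂
    refine ⟨h0, h0, fun _ => ?_, fun h => absurd hg h⟩
    refine searchStep_wp hs hw hn hσ₂ (by omega) hR _ (fun i hi => absurd hi (by simp [hemp₂])) ?_
      (fun _ h => by omega)
    intro _ _ σ₃ hσ₃ hm₃ ho₃
    -- The left part wrote only below `j`, so address `j` still holds the right end `e`.
    rw [hm₂ j le_rfl, hm₁, Function.update_self] at hσ₃
    refine Or.inl ⟨hσ₃.running, ?_⟩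
    refine ih (by omega) hσ₃ heR _ ?_
    intro σ₄ x₄ L₄ hemp₄ hσ₄ hm₄ ho₄ hnd₄ hL₄
    refine H σ₄ x₄ (j :: (L₂ ++ L₄)) hemp₄ hσ₄ (fun i hi => ?_) ?_ ?_ ?_
    · rw [hm₄ i hi, hm₃, hm₂ i (by omega), hm₁, Function.update_of_ne (by omega)]
    · simp [ho₄, ho₃, ho₂, ho₁]
    · have m₂ : ∀ k, k ∈ L₂ → k < j := fun k hk => by
        rw [← List.mem_toFinset, hL₂, mem_hits] at hk
        omega
      have m₄ : ∀ k, k ∈ L₄ → j < k := fun k hk => by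
        rw [← List.mem_toFinset, hL₄, mem_hits] at hk
        omega
      rw [List.nodup_cons, List.nodup_append]
      refine ⟨fun h => ?_, hnd₂, hnd₄, fun a ha b hb => ?_⟩
      · rcases List.mem_append.1 h with h | h
        · exact lt_irrefl _ (m₂ j h)
        · exact lt_irrefl _ (m₄ j h)
      · have := m₂ a ha
        have := m₄ b hb
        omega
    · rw [hsplit, List.toFinset_cons, List.toFinset_append, hL₂, hL₄]

/-- The state in which exactly the accepted indices in `[x, R)` have been reported. -/
def Reported (accept : ℕ → Bool) (x R : ℕ) (σ : Store) : Prop :=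
  σ.out.Nodup ∧ σ.out.toFinset = hits accept x R

/-- The extra round is the one that finds the range exhausted with right end `R`, so that nothing is
pending, and sets the stop flag. -/
theorem loopWp_search (hs : Searches w g accept n search) (hw : 0 < w) (hg : 0 < g 0)
    (hn : n < 2 ^ w) {x R : ℕ} (hR : R ≤ n) {σ : Store} (hσ : AtRange σ x R R) (ho : σ.out = []) :
    (reportStep search).loopWp w g accept 3 (Reported accept x R)
      (1 + 2 * (hits accept x R).card) σ := by
  have h0 : 0 < 2 ^ w := by positivity
  refine loopWp_range hs hw hg hn hR (R - x) le_rfl hσ le_rfl 1 ?_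
  intro σ₁ x₁ L hemp hσ₁ _ ho₁ hnd hL
  refine ⟨h0, h0, fun _ => ?_, fun h => absurd hg h⟩
  refine searchStep_wp hs hw hn hσ₁ le_rfl hR _ (fun i hi => absurd hi (by simp [hemp]))
    (fun _ h => absurd h (lt_irrefl _)) ?_
  intro _ _ σ₂ h₂ ho₂
  refine Or.inr ⟨h₂, ?_⟩
  rw [Reported, ho₂, ho₁, ho, List.nil_append]
  exact ⟨hnd, hL⟩

theorem loopWp_scan (hw : 0 < w) (hg : g 0 = 0) (hn : n < 2 ^ w) {x₀ R : ℕ} (hR : R ≤ n) (m : ℕ) :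
    ∀ {σ : Store} {x : ℕ}, R - x ≤ m → x₀ ≤ x → x ≤ R → AtRange σ x R R →
      Reported accept x₀ x σ →
      (reportStep search).loopWp w g accept 3 (Reported accept x₀ R) (m + 1) σ := by
  have h0 : 0 < 2 ^ w := by positivity
  have h1 : 1 < 2 ^ w := Nat.one_lt_two_pow hw.ne'
  induction m with
  | zero =>
    intro σ x hx hx₀ hxR hσ hrep
    obtain rfl : x = R := by omega
    refine ⟨h0, h0, fun h => by simp [hg] at h, fun _ => ?_⟩
    refine ⟨trivial, trivial, fun h => ?_, fun _ => ⟨h1, Or.inr ⟨by simp [Store.set], hrep⟩⟩⟩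
    simp [hσ.left, hσ.right] at h
  | succ m ih =>
    intro σ x hx hx₀ hxR hσ hrep
    refine ⟨h0, h0, fun h => by simp [hg] at h, fun _ => ?_⟩
    refine ⟨trivial, trivial, fun h => ?_, fun h => ⟨h1, Or.inr ⟨by simp [Store.set], ?_⟩⟩⟩
    · simp only [Expr.val_reg, hσ.left, hσ.right] at h
      have hfit : σ.reg 0 + 1 < 2 ^ w := by
        rw [hσ.left]
        omega
      refine ⟨trivial, h0, trivial, fun ha => ?_, fun ha => ?_⟩
      · refine ⟨trivial, ⟨trivial, h1, ?_⟩, Or.inl ⟨by simp [Store.set, hσ.running],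
          ih (x := x + 1) (by omega) (by omega) (by omega) ?_ ?_⟩⟩
        · exact hfit
        · constructor <;> simp [Store.set, hσ.left, hσ.right, hσ.last, hσ.running]
        · have ha : accept x = true := by
            by_contra hc
            simp [Store.set, hσ.left, hc] at ha
          obtain ⟨hnd, ho⟩ := hrep
          refine ⟨?_, ?_⟩
          · have hnot : x ∉ σ.out := by
              rw [← List.mem_toFinset, ho]
              simp
            show (σ.out ++ [σ.reg 0]).Nodup
            rw [hσ.left, List.nodup_append]
            exact ⟨hnd, List.nodup_singleton x, fun a ha b hb h =>
              hnot (by rwa [← List.mem_singleton.1 hb, ← h])⟩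
          · ext k
            simp only [Store.set, Expr.val_reg, List.toFinset_append, Finset.mem_union, ho, mem_hits]
            simp only [ne_eq, OfNat.zero_ne_ofNat, not_false_eq_true, Function.update_of_ne, hσ.left,
              List.toFinset_cons, List.toFinset_nil, insert_empty_eq, Finset.mem_singleton]
            constructor
            · rintro (⟨h, h'⟩ | rfl)
              · exact ⟨by omega, h'⟩
              · exact ⟨by omega, ha⟩
            · rintro ⟨h, h'⟩
              by_cases hk : k = x
              · exact Or.inr hk
              · exact Or.inl ⟨by omega, h'⟩
      · refine ⟨⟨trivial, h1, ?_⟩, Or.inl ⟨by simp [Store.set, hσ.running],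
          ih (x := x + 1) (by omega) (by omega) (by omega) ?_ ?_⟩⟩
        · exact hfit
        · constructor <;> simp [Store.set, hσ.left, hσ.right, hσ.last, hσ.running]
        · have ha : accept x = false := by
            by_contra hc
            simp [Store.set, hσ.left, hc] at ha
          obtain ⟨hnd, ho⟩ := hrep
          refine ⟨hnd, ?_⟩
          show σ.out.toFinset = _
          rw [ho]
          ext k
          simp only [mem_hits]
          constructor
          · rintro ⟨h, h'⟩
            exact ⟨by omega, h'⟩
          · rintro ⟨h, h'⟩
            refine ⟨⟨h.1, ?_⟩, h'⟩
            by_contra hc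
            obtain rfl : k = x := by omega
            simp [ha] at h'
    · simp only [Expr.val_reg, hσ.left, hσ.right] at h
      obtain rfl : x = R := by omega
      exact hrep

theorem reportInit_wp (hw : 0 < w) (hn : n < 2 ^ w) {l r : ℕ} (hr : r < n) {Q : Store → Prop}
    (h : ∀ σ, AtRange σ l (r + 1) (r + 1) → σ.out = [] → Q σ) :
    reportInit.wp w g accept Q (Store.start l r) := by
  refine ⟨⟨trivial, Nat.one_lt_two_pow hw.ne', ?_⟩, trivial, h _ ?_ rfl⟩
  · show r + 1 < 2 ^ w
    omega
  · constructor <;> simp [Store.set, Store.start]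

end Loop
end RangeReport

namespace RangeReport

/-! ### The directory and the search for an accepted index in constant time. -/

/-- `g` lists the words of a directory of the sequence `A` of length `n`, for blocks of `b`
entries and superblocks of `b` blocks.  It contains the types of the blocks from position `o₁` on,
positions of the maxima of the blocks from `oM` on, the types of the superblocks from `o₂` on, and
two tables at `oL` and `oG` that lead to entries of a sparse table on the superblocks. -/
structure IsDirectory {β : Type*} [LinearOrder β] (w n : ℕ) (g : ℕ → ℕ) (A : ℕ → β)
    (b o₁ oM o₂ oL oG : ℕ) : Prop where
  pos : 0 < b
  head : g 0 = b ∧ g 1 = o₁ ∧ g 2 = oM ∧ g 3 = o₂ ∧ g 4 = oL ∧ g 5 = oG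
  five_lt : 5 < 2 ^ w
  block : ∀ k i j, i ≤ j → j < b → k * b + j < n →
    o₁ + k < 2 ^ w ∧ g (o₁ + k) + (i * b + j) < 2 ^ w ∧
      i ≤ g (g (o₁ + k) + (i * b + j)) ∧ g (g (o₁ + k) + (i * b + j)) ≤ j ∧
      ∀ q, i ≤ q → q ≤ j → A (k * b + q) ≤ A (k * b + g (g (o₁ + k) + (i * b + j)))
  top : ∀ k, (k + 1) * b ≤ n →
    oM + k < 2 ^ w ∧ k * b ≤ g (oM + k) ∧ g (oM + k) < (k + 1) * b ∧
      ∀ q, k * b ≤ q → q < (k + 1) * b → A q ≤ A (g (oM + k))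
  superblock : ∀ k i j, i ≤ j → j < b → (k * b + j + 1) * b ≤ n →
    o₂ + k < 2 ^ w ∧ g (o₂ + k) + (i * b + j) < 2 ^ w ∧
      i ≤ g (g (o₂ + k) + (i * b + j)) ∧ g (g (o₂ + k) + (i * b + j)) ≤ j ∧
      ∀ q, i ≤ q → q ≤ j → A (g (oM + (k * b + q))) ≤
        A (g (oM + (k * b + g (g (o₂ + k) + (i * b + j)))))
  sparse : ∀ u v, u < v → v * (b * b) ≤ n →
    oL + (v - u) < 2 ^ w ∧ oG + (v - u) < 2 ^ w ∧ g (oL + (v - u)) + u < 2 ^ w ∧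
      g (oL + (v - u)) + u + g (oG + (v - u)) < 2 ^ w ∧
      (u * (b * b) ≤ g (g (oL + (v - u)) + u) ∧ g (g (oL + (v - u)) + u) < v * (b * b)) ∧
      (u * (b * b) ≤ g (g (oL + (v - u)) + u + g (oG + (v - u))) ∧
        g (g (oL + (v - u)) + u + g (oG + (v - u))) < v * (b * b)) ∧
      ∀ q, u * (b * b) ≤ q → q < v * (b * b) → A q ≤ A (g (g (oL + (v - u)) + u)) ∨
        A q ≤ A (g (g (oL + (v - u)) + u + g (oG + (v - u))))

/-! ### The search program -/

/-- The size of the blocks. -/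
def blockSize : Expr := .look (.const 0)

/-- The answer to the query `(i, j)` for the type found in entry `k` of the array whose position
is given by word `c` of the data structure. -/
def typeQuery (c : ℕ) (k i j : Expr) : Expr :=
  .look (.look (.look (.const c) + k) + (i * blockSize + j))

/-- The position of a maximum among the entries `i, …, j` of block `k`. -/
def inBlock (k i j : Expr) : Expr := k * blockSize + typeQuery 1 k i j

/-- The position of a maximum in the blocks `i, …, j` of superblock `k`. -/
def inSuper (k i j : Expr) : Expr := .look (.look (.const 2) + (k * blockSize + typeQuery 3 k i j))

/-- The position in the sparse table of the first entry for the superblocks `u, …, v - 1`. -/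
def sparseEntry (u v : Expr) : Expr := .look (.look (.const 4) + (v - u)) + u

/-- The first candidate for a maximum in the superblocks `u, …, v - 1`. -/
def sparseLeft (u v : Expr) : Expr := .look (sparseEntry u v)

/-- The second candidate for a maximum in the superblocks `u, …, v - 1`. -/
def sparseRight (u v : Expr) : Expr :=
  .look (sparseEntry u v + .look (.look (.const 5) + (v - u)))

/-- Examine the index `c` unless the search has already been successful. -/
def tryIndex (c : Expr) : Code :=
  .ifLt (.const 0) (.reg 4) .skip (.seq (.set 5 c) (.ask 4 (.reg 5)))

/-- The last index of the current range. -/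
def lastIndex : Expr := .reg 1 - .const 1

/-- The block of the first index of the current range. -/
def firstBlock : Expr := .reg 0 / blockSize

/-- The block of the last index of the current range. -/
def lastBlock : Expr := lastIndex / blockSize

/-- The block after the first one. -/
def secondBlock : Expr := firstBlock + .const 1

/-- The block before the last one. -/
def penultBlock : Expr := lastBlock - .const 1

/-- The superblock of the second block. -/
def firstSuper : Expr := secondBlock / blockSize

/-- The superblock of the last block but one. -/
def lastSuper : Expr := penultBlock / blockSize

/-- Search for an accepted index in a sequence of superblocks. -/
def searchSuper : Code :=
  .ifLt firstSuper lastSuper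
    (.seq (tryIndex (inSuper firstSuper (secondBlock % blockSize) (blockSize - .const 1)))
      (.seq (tryIndex (inSuper lastSuper (.const 0) (penultBlock % blockSize)))
        (.ifLt (firstSuper + .const 1) lastSuper
          (.seq (tryIndex (sparseLeft (firstSuper + .const 1) lastSuper))
            (tryIndex (sparseRight (firstSuper + .const 1) lastSuper)))
          .skip)))
    (tryIndex (inSuper firstSuper (secondBlock % blockSize) (penultBlock % blockSize)))

/-- Search for an accepted index in the current range. -/
def searchRange : Code :=
  .ifLt firstBlock lastBlock
    (.seq (tryIndex (inBlock firstBlock (.reg 0 % blockSize) (blockSize - .const 1)))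
      (.seq (tryIndex (inBlock lastBlock (.const 0) (lastIndex % blockSize)))
        (.ifLt secondBlock lastBlock searchSuper .skip)))
    (tryIndex (inBlock firstBlock (.reg 0 % blockSize) (lastIndex % blockSize)))

/-! ### Correctness of the search. -/

section Search

variable {β : Type*} [LinearOrder β] {w n : ℕ} {g : ℕ → ℕ} {A : ℕ → β} {b o₁ oM o₂ oL oG : ℕ}
  {accept : ℕ → Bool}

theorem inBlock_spec (D : IsDirectory w n g A b o₁ oM o₂ oL oG) (hn : n < 2 ^ w) {σ : Store}
    {k i j : Expr} (hk : k.Fits w g σ) (hi : i.Fits w g σ) (hj : j.Fits w g σ)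
    (hij : i.val g σ ≤ j.val g σ) (hjb : j.val g σ < b) (hkj : k.val g σ * b + j.val g σ < n) :
    (inBlock k i j).Fits w g σ ∧
      k.val g σ * b + i.val g σ ≤ (inBlock k i j).val g σ ∧
      (inBlock k i j).val g σ ≤ k.val g σ * b + j.val g σ ∧
      ∀ q, k.val g σ * b + i.val g σ ≤ q → q ≤ k.val g σ * b + j.val g σ →
        A q ≤ A ((inBlock k i j).val g σ) := by
  obtain ⟨h0, h1, -⟩ := D.head
  have h5 := D.five_lt
  obtain ⟨a₁, a₂, a₃, a₄, a₅⟩ := D.block _ _ _ hij hjb hkj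
  simp only [inBlock, typeQuery, blockSize, Expr.fits_add, Expr.fits_mul, Expr.fits_look,
    Expr.fits_const, Expr.val_add, Expr.val_mul, Expr.val_look, Expr.val_const, h0, h1]
  refine ⟨⟨⟨hk, by omega, by omega⟩, ⟨⟨by omega, hk, a₁⟩, ⟨⟨hi, by omega, by omega⟩, hj, by omega⟩,
    a₂⟩, by omega⟩, by omega, by omega, fun q hq hq' => ?_⟩
  have := a₅ (q - k.val g σ * b) (by omega) (by omega)
  rwa [show k.val g σ * b + (q - k.val g σ * b) = q by omega] at this

/-- The table selects a block with the largest block maximum and the array at `oM` gives the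
position of that maximum. An entry is bounded by the maximum of its own block, and this by the
maximum of the selected block. All blocks concerned must be complete, as maxima are specified only
for those. -/
theorem inSuper_spec (D : IsDirectory w n g A b o₁ oM o₂ oL oG) {σ : Store}
    {k i j : Expr} (hk : k.Fits w g σ) (hi : i.Fits w g σ) (hj : j.Fits w g σ)
    (hij : i.val g σ ≤ j.val g σ) (hjb : j.val g σ < b)
    (hkj : (k.val g σ * b + j.val g σ + 1) * b ≤ n) :
    (inSuper k i j).Fits w g σ ∧
      (k.val g σ * b + i.val g σ) * b ≤ (inSuper k i j).val g σ ∧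
      (inSuper k i j).val g σ < (k.val g σ * b + j.val g σ + 1) * b ∧
      ∀ q, k.val g σ * b + i.val g σ ≤ q / b → q / b ≤ k.val g σ * b + j.val g σ →
        A q ≤ A ((inSuper k i j).val g σ) := by
  obtain ⟨h0, -, h2, h3, -⟩ := D.head
  have h5 := D.five_lt
  obtain ⟨a₁, a₂, a₃, a₄, a₅⟩ := D.superblock _ _ _ hij hjb hkj
  simp only [inSuper, typeQuery, blockSize, Expr.fits_add, Expr.fits_mul, Expr.fits_look,
    Expr.fits_const, Expr.val_add, Expr.val_mul, Expr.val_look, Expr.val_const, h0, h2, h3]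
  set p := g (g (o₂ + k.val g σ) + (i.val g σ * b + j.val g σ))
  have le_n : ∀ z, z ≤ k.val g σ * b + j.val g σ → (z + 1) * b ≤ n := fun z hz =>
    (Nat.mul_le_mul_right b (by omega)).trans hkj
  obtain ⟨t₁, t₂, t₃, -⟩ := D.top (k.val g σ * b + p) (le_n _ (by omega))
  have hkb : k.val g σ * b + p < 2 ^ w := by
    have := Nat.le_mul_of_pos_right (k.val g σ * b + p) D.pos
    rw [add_mul] at t₃
    omega
  refine ⟨⟨by omega, ⟨⟨hk, by omega, by omega⟩, ⟨⟨by omega, hk, a₁⟩,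
    ⟨⟨hi, by omega, by omega⟩, hj, by omega⟩, a₂⟩, hkb⟩, t₁⟩,
    (Nat.mul_le_mul_right b (by omega)).trans t₂,
    lt_of_lt_of_le t₃ (Nat.mul_le_mul_right b (by omega)), fun q hq hq' => ?_⟩
  have ht := (D.top (q / b) (le_n _ hq')).2.2.2 q (Nat.div_mul_le_self q b)
    (Nat.lt_mul_of_div_lt (Nat.lt_succ_self _) D.pos)
  have := a₅ (q / b - k.val g σ * b) (by omega) (by omega)
  rw [show k.val g σ * b + (q / b - k.val g σ * b) = q / b by omega] at this
  exact ht.trans this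

theorem sparse_spec (D : IsDirectory w n g A b o₁ oM o₂ oL oG) {σ : Store}
    {u v : Expr} (hu : u.Fits w g σ) (hv : v.Fits w g σ) (huv : u.val g σ < v.val g σ)
    (hvn : v.val g σ * (b * b) ≤ n) :
    ((sparseLeft u v).Fits w g σ ∧ u.val g σ * (b * b) ≤ (sparseLeft u v).val g σ ∧
      (sparseLeft u v).val g σ < v.val g σ * (b * b)) ∧
    ((sparseRight u v).Fits w g σ ∧ u.val g σ * (b * b) ≤ (sparseRight u v).val g σ ∧
      (sparseRight u v).val g σ < v.val g σ * (b * b)) ∧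
    ∀ q, u.val g σ * (b * b) ≤ q → q < v.val g σ * (b * b) →
      A q ≤ A ((sparseLeft u v).val g σ) ∨ A q ≤ A ((sparseRight u v).val g σ) := by
  obtain ⟨h0, -, -, -, h4, h5⟩ := D.head
  have h5' := D.five_lt
  obtain ⟨a₁, a₂, a₃, a₄, a₅, a₆, a₇⟩ := D.sparse _ _ huv hvn
  simp only [sparseLeft, sparseRight, sparseEntry, Expr.fits_add, Expr.fits_sub, Expr.fits_look,
    Expr.fits_const, Expr.val_add, Expr.val_sub, Expr.val_look, Expr.val_const, h4, h5]
  have huv' := huv.le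
  have c₄ : 4 < 2 ^ w := by omega
  exact ⟨⟨⟨⟨c₄, ⟨hv, hu, huv'⟩, a₁⟩, hu, a₃⟩, a₅⟩,
    ⟨⟨⟨⟨c₄, ⟨hv, hu, huv'⟩, a₁⟩, hu, a₃⟩, ⟨h5', ⟨hv, hu, huv'⟩, a₂⟩, a₄⟩, a₆⟩, a₇⟩

theorem sparseLeft_congr {σ σ' : Store} {u v : Expr} (hu : u.val g σ = u.val g σ')
    (hv : v.val g σ = v.val g σ') : (sparseLeft u v).val g σ = (sparseLeft u v).val g σ' := by
  simp only [sparseLeft, sparseEntry, Expr.val_add, Expr.val_sub, Expr.val_look, Expr.val_const,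
    hu, hv]

theorem Searched.mono {p p' : ℕ → Prop} {σ₀ σ : Store} (h : Searched accept p σ₀ σ)
    (hp : ∀ k, p' k → p k) : Searched accept p' σ₀ σ := by
  obtain ⟨f, i, rfl, ⟨hf, hk⟩ | hi⟩ := h
  · exact ⟨f, i, rfl, Or.inl ⟨hf, fun k h => hk k (hp k h)⟩⟩
  · exact ⟨f, i, rfl, Or.inr hi⟩

theorem Searched.reg_zero {p : ℕ → Prop} {σ₀ σ : Store} (h : Searched accept p σ₀ σ) :
    σ.reg 0 = σ₀.reg 0 := by
  obtain ⟨f, i, rfl, -⟩ := h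
  simp [Store.set]

theorem Searched.reg_one {p : ℕ → Prop} {σ₀ σ : Store} (h : Searched accept p σ₀ σ) :
    σ.reg 1 = σ₀.reg 1 := by
  obtain ⟨f, i, rfl, -⟩ := h
  simp [Store.set]

/-- Rejecting a candidate rules out every index whose entry is at most that of the candidate. The
excluded sets thus accumulate over successive attempts, and after a success later attempts do
nothing. -/
theorem tryIndex_wp (hA : ∀ i j, A i ≤ A j → accept i = true → accept j = true)
    {c : Expr} {p p' : ℕ → Prop} {σ₀ σ : Store} {Q : Store → Prop}
    (hσ : Searched accept p σ₀ σ) (hc : c.Fits w g σ) (hl : σ₀.reg 0 ≤ c.val g σ)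
    (hr : c.val g σ < σ₀.reg 1) (hp : ∀ q, p' q → A q ≤ A (c.val g σ))
    (hQ : ∀ σ', Searched accept (fun k => p k ∨ p' k) σ₀ σ' → Q σ') :
    (tryIndex c).wp w g accept Q σ := by
  have h0 : 0 < 2 ^ w := by positivity
  obtain ⟨f, i, hσ, H⟩ := hσ
  have hf : σ.reg 4 = f := by simp [hσ, Store.set]
  refine ⟨h0, trivial, fun h => hQ _ ⟨f, i, hσ, ?_⟩, fun h => ⟨hc, trivial, hQ _ ?_⟩⟩
  · rcases H with ⟨rfl, -⟩ | H
    · simp [hf] at h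
    · exact Or.inr H
  · have hf0 : f = 0 := by simpa [hf] using h
    have hk : ∀ k, p k → accept k = false := by
      rcases H with ⟨-, hk⟩ | ⟨rfl, -⟩
      · exact hk
      · simp at hf0
    refine ⟨if accept (c.val g σ) then 1 else 0, c.val g σ, ?_, ?_⟩
    · generalize c.val g σ = z
      subst hσ
      ext r
      · by_cases h4 : r = 4
        · subst h4
          simp [Store.set]
        · by_cases h5 : r = 5
          · subst h5
            simp [Store.set]
          · simp [Store.set, h4, h5]
      · rfl
      · rfl
    · by_cases ha : accept (c.val g σ) = true
      · exact Or.inr ⟨by simp [ha], by simp [hl, hr, ha]⟩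
      · refine Or.inl ⟨by simp [ha], fun k hk' => ?_⟩
        rcases hk' with hk' | hk'
        · exact hk k hk'
        · by_contra h
          exact ha (hA _ _ (hp k hk') (by simpa using h))

/-- The blocks strictly between the two end blocks are complete. They split into the end of one
superblock, the start of another, and whole superblocks in between; or they lie in one superblock.
-/
theorem searchSuper_wp (D : IsDirectory w n g A b o₁ oM o₂ oL oG) (hn : n < 2 ^ w)
    (hA : ∀ i j, A i ≤ A j → accept i = true → accept j = true) {p : ℕ → Prop} {σ₀ σ : Store}
    {Q : Store → Prop} (hσ : Searched accept p σ₀ σ) (he : 0 < σ₀.reg 1) (hen : σ₀.reg 1 ≤ n)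
    (hXY : σ₀.reg 0 / b + 1 < (σ₀.reg 1 - 1) / b)
    (hQ : ∀ σ', Searched accept
      (fun k => p k ∨ (σ₀.reg 0 / b < k / b ∧ k / b < (σ₀.reg 1 - 1) / b)) σ₀ σ' → Q σ') :
    searchSuper.wp w g accept Q σ := by
  have hb := D.pos
  have h0 : g 0 = b := D.head.1
  have c0 : 0 < 2 ^ w := by positivity
  have c1 : 1 < 2 ^ w := by have := D.five_lt; omega
  generalize hX : σ₀.reg 0 / b = X at *
  generalize hY : (σ₀.reg 1 - 1) / b = Y at *
  have hxX : σ₀.reg 0 < (X + 1) * b := by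
    rw [← hX]
    exact Nat.lt_mul_of_div_lt (Nat.lt_succ_self _) hb
  have hYe : Y * b < σ₀.reg 1 := by
    have := Nat.div_mul_le_self (σ₀.reg 1 - 1) b
    rw [hY] at this
    omega
  have hYb : Y ≤ Y * b := Nat.le_mul_of_pos_right Y hb
  -- The expressions depend only on registers `0` and `1`, which no attempt changes, so their values
  -- stay the same in all intermediate states.
  have vals : ∀ {p σ}, Searched accept p σ₀ σ →
      (firstSuper.Fits w g σ ∧ lastSuper.Fits w g σ ∧ (secondBlock % blockSize).Fits w g σ ∧
        (penultBlock % blockSize).Fits w g σ ∧ (blockSize - .const 1).Fits w g σ ∧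
        (firstSuper + .const 1).Fits w g σ) ∧
      firstSuper.val g σ = (X + 1) / b ∧ lastSuper.val g σ = (Y - 1) / b ∧
      (secondBlock % blockSize).val g σ = (X + 1) % b ∧
      (penultBlock % blockSize).val g σ = (Y - 1) % b ∧ (blockSize - .const 1).val g σ = b - 1 ∧
      (firstSuper + .const 1).val g σ = (X + 1) / b + 1 := by
    intro p σ hσ
    have hd := Nat.div_le_self (X + 1) b
    simp only [firstSuper, lastSuper, secondBlock, penultBlock, firstBlock, lastBlock, lastIndex,
      blockSize, Expr.fits_add, Expr.fits_sub, Expr.fits_div, Expr.fits_mod, Expr.fits_look,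
      Expr.fits_const, Expr.fits_reg, Expr.val_add, Expr.val_sub, Expr.val_div, Expr.val_mod,
      Expr.val_look, Expr.val_const, Expr.val_reg, hσ.reg_zero, hσ.reg_one, h0, hX, hY]
    refine ⟨⟨?_, ?_, ?_, ?_, ?_, ?_⟩, trivial, trivial, trivial, trivial, trivial, trivial⟩ <;>
      simp only [c0, c1, true_and, and_true] <;> omega
  have hu := Nat.div_add_mod' (X + 1) b
  have hv := Nat.div_add_mod' (Y - 1) b
  have hub := Nat.mod_lt (X + 1) hb
  have hvb := Nat.mod_lt (Y - 1) hb
  have huv : (X + 1) / b ≤ (Y - 1) / b := Nat.div_le_div_right (by omega)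
  generalize hsu : (X + 1) / b = su at *
  generalize hsv : (Y - 1) / b = sv at *
  generalize (X + 1) % b = i at *
  generalize (Y - 1) % b = j at *
  have below : ∀ z, z ≤ Y → z * b < σ₀.reg 1 := fun z hz =>
    lt_of_le_of_lt (Nat.mul_le_mul_right b hz) hYe
  have above : ∀ z, X + 1 ≤ z → σ₀.reg 0 < z * b := fun z hz =>
    lt_of_lt_of_le hxX (Nat.mul_le_mul_right b hz)
  have supers : su < sv → (su + 1) * b ≤ sv * b := fun h => Nat.mul_le_mul_right b h
  have sucm := add_one_mul su b
  obtain ⟨⟨f₁, f₂, f₃, f₄, f₅, -⟩, v₁, v₂, v₃, v₄, v₅, -⟩ := vals hσ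
  refine ⟨f₁, f₂, fun hlt => ?_, fun hlt => ?_⟩
  · rw [v₁, v₂] at hlt
    have hs := supers hlt
    obtain ⟨s₁, s₂, s₃, s₄⟩ := inSuper_spec D f₁ f₃ f₅ (by omega) (by omega)
      (by rw [v₁, v₅]; exact ((below _ (by omega)).trans_le hen).le)
    rw [v₁, v₃] at s₂
    rw [v₁, v₅] at s₃
    rw [v₁, v₃, v₅] at s₄
    refine tryIndex_wp hA hσ s₁ ((above _ (by omega)).le.trans s₂)
      (s₃.trans (below _ (by omega)))
      (fun q (hq : su * b + i ≤ q / b ∧ q / b ≤ su * b + (b - 1)) => s₄ q hq.1 hq.2) fun σ hσ => ?_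
    obtain ⟨⟨f₁, f₂, f₃, f₄, f₅, -⟩, v₁, v₂, v₃, v₄, v₅, -⟩ := vals hσ
    obtain ⟨s₁, s₂, s₃, s₄⟩ := inSuper_spec D (i := .const 0) f₂ c0 f₄ (Nat.zero_le _) (by omega)
      (by rw [v₂, v₄]; exact ((below _ (by omega)).trans_le hen).le)
    rw [v₂, Expr.val_const] at s₂
    rw [v₂, v₄] at s₃
    rw [v₂, Expr.val_const, v₄] at s₄
    refine tryIndex_wp hA hσ s₁ ((above _ (by omega)).le.trans s₂)
      (s₃.trans (below _ (by omega)))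
      (fun q (hq : sv * b + 0 ≤ q / b ∧ q / b ≤ sv * b + j) => s₄ q hq.1 hq.2) fun σ hσ => ?_
    obtain ⟨⟨-, f₂, -, -, -, f₆⟩, -, v₂, -, -, -, v₆⟩ := vals hσ
    refine ⟨f₆, f₂, fun hlt' => ?_, fun hlt' => hQ _ (hσ.mono fun k hk => ?_)⟩
    · rw [v₂, v₆] at hlt'
      have hvn : sv * (b * b) ≤ n := by
        rw [← mul_assoc]
        exact ((below _ (by omega)).trans_le hen).le
      have hlow : σ₀.reg 0 < (su + 1) * (b * b) := by
        rw [← mul_assoc]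
        exact above _ (by omega)
      have hhigh : sv * (b * b) < σ₀.reg 1 := by
        rw [← mul_assoc]
        exact below _ (by omega)
      obtain ⟨s₁, -, t⟩ := sparse_spec D f₆ f₂ (by omega) (by rw [v₂]; exact hvn)
      rw [v₂, v₆] at s₁ t
      refine tryIndex_wp hA hσ s₁.1 (hlow.le.trans s₁.2.1) (s₁.2.2.trans hhigh)
        -- It is unknown which of the two candidates bounds a given index. Hence each attempt
        -- excludes all indices below its own candidate, and the two sets together cover the
        -- superblocks.
        (p' := fun q => A q ≤ A ((sparseLeft (firstSuper + .const 1) lastSuper).val g σ))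
        (fun _ h => h) fun σ' hσ' => ?_
      obtain ⟨⟨-, f₂, -, -, -, f₆⟩, -, v₂', -, -, -, v₆'⟩ := vals hσ'
      have e₁ : (sparseLeft (firstSuper + .const 1) lastSuper).val g σ' =
          (sparseLeft (firstSuper + .const 1) lastSuper).val g σ :=
        sparseLeft_congr (v₆'.trans v₆.symm) (v₂'.trans v₂.symm)
      obtain ⟨-, s₂, t⟩ := sparse_spec D f₆ f₂ (by omega) (by rw [v₂']; exact hvn)
      rw [v₂', v₆'] at s₂ t
      refine tryIndex_wp hA hσ' s₂.1 (hlow.le.trans s₂.2.1) (s₂.2.2.trans hhigh)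
        (p' := fun q => A q ≤ A ((sparseRight (firstSuper + .const 1) lastSuper).val g σ'))
        (fun _ h => h) fun σ'' hσ'' => hQ _ (hσ''.mono fun k hk => ?_)
      rw [← e₁]
      rcases hk with hk | ⟨hk₁, hk₂⟩
      · exact Or.inl (Or.inl (Or.inl (Or.inl hk)))
      by_cases h₁ : k / b ≤ su * b + (b - 1)
      · exact Or.inl (Or.inl (Or.inl (Or.inr ⟨by omega, h₁⟩)))
      by_cases h₂ : sv * b ≤ k / b
      · exact Or.inl (Or.inl (Or.inr ⟨by omega, by omega⟩))
      have h₃ : (su + 1) * (b * b) ≤ k := by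
        rw [← mul_assoc]
        exact (Nat.mul_le_mul_right b (by omega)).trans (Nat.div_mul_le_self k b)
      have h₄ : k < sv * (b * b) := by
        rw [← mul_assoc]
        exact Nat.lt_mul_of_div_lt (by omega) hb
      exact (t k h₃ h₄).imp (fun h => Or.inr h) id
    · rw [v₂, v₆] at hlt'
      obtain rfl : sv = su + 1 := by omega
      rcases hk with hk | ⟨hk₁, hk₂⟩
      · exact Or.inl (Or.inl hk)
      by_cases h₁ : k / b ≤ su * b + (b - 1)
      · exact Or.inl (Or.inr ⟨by omega, h₁⟩)
      · exact Or.inr ⟨by omega, by omega⟩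
  · rw [v₁, v₂] at hlt
    obtain rfl : su = sv := by omega
    obtain ⟨s₁, s₂, s₃, s₄⟩ := inSuper_spec D f₁ f₃ f₄ (by omega) (by omega)
      (by rw [v₁, v₄]; exact ((below _ (by omega)).trans_le hen).le)
    rw [v₁, v₃] at s₂
    rw [v₁, v₄] at s₃
    rw [v₁, v₃, v₄] at s₄
    refine tryIndex_wp hA hσ s₁ ((above _ (by omega)).le.trans s₂)
      (s₃.trans (below _ (by omega)))
      (fun q (hq : su * b + i ≤ q / b ∧ q / b ≤ su * b + j) => s₄ q hq.1 hq.2)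
      fun σ hσ => hQ _ (hσ.mono fun k hk => ?_)
    rcases hk with hk | ⟨hk₁, hk₂⟩
    · exact Or.inl hk
    · exact Or.inr ⟨by omega, by omega⟩

theorem searches_searchRange (D : IsDirectory w n g A b o₁ oM o₂ oL oG) (hn : n < 2 ^ w)
    (hA : ∀ i j, A i ≤ A j → accept i = true → accept j = true) :
    Searches w g accept n searchRange := by
  intro σ₀ hlt hen hf
  have hb := D.pos
  have h0 : g 0 = b := D.head.1
  have c0 : 0 < 2 ^ w := by positivity
  have c1 : 1 < 2 ^ w := by have := D.five_lt; omega
  have hσ : Searched accept (fun _ => False) σ₀ σ₀ := by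
    refine ⟨0, σ₀.reg 5, ?_, Or.inl ⟨rfl, by simp⟩⟩
    have h : σ₀.set 4 0 = σ₀ := by
      rw [Store.set, ← hf, Function.update_eq_self]
    rw [h, Store.set, Function.update_eq_self]
  -- Making the postcondition opaque puts the goal into the continuation form of `tryIndex_wp`.
  generalize hQ : Searched accept (fun k => σ₀.reg 0 ≤ k ∧ k < σ₀.reg 1) σ₀ = Q
  replace hQ : ∀ σ, Searched accept (fun k => σ₀.reg 0 ≤ k ∧ k < σ₀.reg 1) σ₀ σ → Q σ :=
    fun σ h => hQ ▸ h
  have hx := Nat.div_add_mod' (σ₀.reg 0) b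
  have hy := Nat.div_add_mod' (σ₀.reg 1 - 1) b
  have hxb := Nat.mod_lt (σ₀.reg 0) hb
  have hyb := Nat.mod_lt (σ₀.reg 1 - 1) hb
  have hdiv : σ₀.reg 0 / b ≤ (σ₀.reg 1 - 1) / b := Nat.div_le_div_right (by omega)
  have vals : ∀ {p σ}, Searched accept p σ₀ σ →
      (firstBlock.Fits w g σ ∧ lastBlock.Fits w g σ ∧ (Expr.reg 0 % blockSize).Fits w g σ ∧
        (lastIndex % blockSize).Fits w g σ ∧ (blockSize - .const 1).Fits w g σ) ∧
      firstBlock.val g σ = σ₀.reg 0 / b ∧ lastBlock.val g σ = (σ₀.reg 1 - 1) / b ∧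
      (Expr.reg 0 % blockSize).val g σ = σ₀.reg 0 % b ∧
      (lastIndex % blockSize).val g σ = (σ₀.reg 1 - 1) % b ∧
      (blockSize - .const 1).val g σ = b - 1 ∧
      secondBlock.val g σ = σ₀.reg 0 / b + 1 := by
    intro p σ hσ
    simp only [secondBlock, firstBlock, lastBlock, lastIndex,
      blockSize, Expr.fits_sub, Expr.fits_div, Expr.fits_mod, Expr.fits_look,
      Expr.fits_const, Expr.fits_reg, Expr.val_add, Expr.val_sub, Expr.val_div, Expr.val_mod,
      Expr.val_look, Expr.val_const, Expr.val_reg, hσ.reg_zero, hσ.reg_one, h0]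
    refine ⟨⟨?_, ?_, ?_, ?_, ?_⟩, trivial, trivial, trivial, trivial, trivial, trivial⟩ <;>
      simp only [c0, c1, true_and, and_true] <;> omega
  generalize hX : σ₀.reg 0 / b = X at *
  generalize hY : (σ₀.reg 1 - 1) / b = Y at *
  generalize σ₀.reg 0 % b = i at *
  generalize (σ₀.reg 1 - 1) % b = j at *
  have sucm := add_one_mul X b
  obtain ⟨⟨f₁, f₂, f₃, f₄, f₅⟩, v₁, v₂, v₃, v₄, v₅, -⟩ := vals hσ
  refine ⟨f₁, f₂, fun hXY => ?_, fun hXY => ?_⟩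
  · rw [v₁, v₂] at hXY
    have hs : (X + 1) * b ≤ Y * b := Nat.mul_le_mul_right b hXY
    obtain ⟨s₁, s₂, s₃, s₄⟩ := inBlock_spec D hn f₁ f₃ f₅ (by omega) (by omega)
      (by rw [v₁, v₅]; omega)
    rw [v₁, v₃] at s₂
    rw [v₁, v₅] at s₃
    rw [v₁, v₃, v₅] at s₄
    refine tryIndex_wp hA hσ s₁ (by omega) (by omega)
      (fun q (hq : X * b + i ≤ q ∧ q ≤ X * b + (b - 1)) => s₄ q hq.1 hq.2) fun σ hσ => ?_
    obtain ⟨⟨f₁, f₂, f₃, f₄, f₅⟩, v₁, v₂, v₃, v₄, v₅, -⟩ := vals hσ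
    obtain ⟨s₁, s₂, s₃, s₄⟩ := inBlock_spec D hn (i := .const 0) f₂ c0 f₄ (Nat.zero_le _) (by omega)
      (by rw [v₂, v₄]; omega)
    rw [v₂, Expr.val_const] at s₂
    rw [v₂, v₄] at s₃
    rw [v₂, Expr.val_const, v₄] at s₄
    refine tryIndex_wp hA hσ s₁ (by omega) (by omega)
      (fun q (hq : Y * b + 0 ≤ q ∧ q ≤ Y * b + j) => s₄ q hq.1 hq.2) fun σ hσ => ?_
    obtain ⟨⟨f₁, f₂, -, -, -⟩, v₁, v₂, -, -, -, v₆⟩ := vals hσ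
    -- What the two end blocks do not cover lies in blocks strictly between them.
    have split : ∀ k, σ₀.reg 0 ≤ k → k < σ₀.reg 1 → ¬ (X * b + i ≤ k ∧ k ≤ X * b + (b - 1)) →
        ¬ (Y * b + 0 ≤ k ∧ k ≤ Y * b + j) → X < k / b ∧ k / b < Y := by
      intro k h₁ h₂ h₃ h₄
      exact ⟨(Nat.le_div_iff_mul_le hb).2 (show (X + 1) * b ≤ k by omega), 
        Nat.div_lt_of_lt_mul (by rw [mul_comm]; omega)⟩
    refine ⟨⟨f₁, c1, ?_⟩, f₂, fun hlt' => ?_, fun hlt' => hQ _ (hσ.mono fun k hk => ?_)⟩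
    · show firstBlock.val g σ + 1 < 2 ^ w
      have := Nat.le_mul_of_pos_right Y hb
      omega
    · rw [v₂, v₆] at hlt'
      refine searchSuper_wp D hn hA hσ (by omega) hen (by rwa [hX, hY])
        fun σ hσ => hQ _ (hσ.mono fun k hk => ?_)
      rw [hX, hY]
      have := split k hk.1 hk.2
      tauto
    · rw [v₂, v₆] at hlt'
      have := split k hk.1 hk.2
      by_contra hc
      have := this (by tauto) (by tauto)
      omega
  · rw [v₁, v₂] at hXY
    obtain rfl : X = Y := by omega
    obtain ⟨s₁, s₂, s₃, s₄⟩ := inBlock_spec D hn f₁ f₃ f₄ (by omega) (by omega)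
      (by rw [v₁, v₄]; omega)
    rw [v₁, v₃] at s₂
    rw [v₁, v₄] at s₃
    rw [v₁, v₃, v₄] at s₄
    refine tryIndex_wp hA hσ s₁ (by omega) (by omega)
      (fun q (hq : σ₀.reg 0 ≤ q ∧ q < σ₀.reg 1) => s₄ q (by omega) (by omega))
      fun σ hσ => hQ _ (hσ.mono fun k hk => Or.inr hk)

end Search
end RangeReport

namespace RangeReport

/-! ### Cartesian trees and the construction of the directory. -/

/-- The answer to the range maximum query `(i, j)` on a sequence with the given Cartesian tree. -/
def treeQuery : BinaryTree Unit → ℕ → ℕ → ℕ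
  | .nil, _, _ => 0
  | .node _ L R, i, j =>
    if j < L.numNodes then treeQuery L i j
    else if L.numNodes < i then
      L.numNodes + 1 + treeQuery R (i - (L.numNodes + 1)) (j - (L.numNodes + 1))
    else L.numNodes

section Construction

variable {β : Type*} [LinearOrder β]

theorem exists_max_Ico (A : ℕ → β) {x y : ℕ} (h : x < y) :
    ∃ p, (x ≤ p ∧ p < y) ∧ ∀ q, x ≤ q → q < y → A q ≤ A p := by
  obtain ⟨p, hp, hmax⟩ := Finset.exists_max_image (Finset.Ico x y) A ⟨x, by simp [h]⟩
  exact ⟨p, Finset.mem_Ico.1 hp, fun q h₁ h₂ => hmax q (Finset.mem_Ico.2 ⟨h₁, h₂⟩)⟩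

/-- Every window of a sequence has a Cartesian tree. -/
theorem exists_cartesianTree (A : ℕ → β) (m : ℕ) : ∀ x, ∃ τ : BinaryTree Unit, τ.numNodes = m ∧
    ∀ i j, i ≤ j → j < m → (i ≤ treeQuery τ i j ∧ treeQuery τ i j ≤ j) ∧
      ∀ q, i ≤ q → q ≤ j → A (x + q) ≤ A (x + treeQuery τ i j) := by
  induction m using Nat.strong_induction_on with
  | _ m ih =>
    intro x
    rcases Nat.eq_zero_or_pos m with rfl | hm
    · exact ⟨.nil, rfl, fun i j _ h => absurd h (Nat.not_lt_zero j)⟩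
    -- The root is placed at a maximum `p`: it answers every query that contains `p`, and any other
    -- query lies entirely on one side of it.
    obtain ⟨p, hp, hmax⟩ := exists_max_Ico A (show x < x + m by omega)
    obtain ⟨L, hL, hL'⟩ := ih (p - x) (by omega) x
    obtain ⟨R, hR, hR'⟩ := ih (m - (p - x + 1)) (by omega) (p + 1)
    refine ⟨.node () L R, by simp only [BinaryTree.numNodes, hL, hR]; omega, fun i j hij hj => ?_⟩
    simp only [treeQuery, hL]
    split_ifs with h₁ h₂
    · exact hL' i j hij h₁
    · obtain ⟨hr, hr'⟩ := hR' (i - (p - x + 1)) (j - (p - x + 1)) (by omega) (by omega)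
      refine ⟨by omega, fun q hq hq' => ?_⟩
      have := hr' (q - (p - x + 1)) (by omega) (by omega)
      rw [show p + 1 + (q - (p - x + 1)) = x + q by omega] at this
      refine this.trans_eq (congrArg A ?_)
      omega
    · refine ⟨by omega, fun q hq hq' => ?_⟩
      rw [show x + (p - x) = p by omega]
      exact hmax _ (by omega) (by omega)

/-- The number of words of the directory of a sequence of length `n` with blocks of length `b`. -/
def directorySize (n b : ℕ) : ℕ :=
  6 + (n / b + 1) + n / b + (n / (b * b) + 1) + (n / (b * b) + 1) + (n / (b * b) + 1) +
    4 ^ b * (b * b) + (Nat.log 2 n + 1) * (n / (b * b))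

/-- The concatenation of finite sequences, each given by its length and its entries. -/
def layout : List (ℕ × (ℕ → ℕ)) → ℕ → ℕ
  | [], _ => 0
  | (N, f) :: L, a => if a < N then f a else layout L (a - N)

theorem layout_lt {N a : ℕ} {f : ℕ → ℕ} {L : List (ℕ × (ℕ → ℕ))} (h : a < N) :
    layout ((N, f) :: L) a = f a := if_pos h

theorem layout_add (N a : ℕ) (f : ℕ → ℕ) (L : List (ℕ × (ℕ → ℕ))) :
    layout ((N, f) :: L) (N + a) = layout L a := by
  rw [layout, if_neg (by omega), Nat.add_sub_cancel_left]

/-- The Catalan number is at most the central binomial coefficient, a single term of the sum 2^(2b).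
-/
theorem card_trees_le (b : ℕ) : (BinaryTree.treesOfNumNodesEq b).card ≤ 4 ^ b := by
  rw [BinaryTree.treesOfNumNodesEq_card_eq_catalan, catalan_eq_centralBinom_div]
  refine (Nat.div_le_self _ _).trans ?_
  rw [Nat.centralBinom, show (4 : ℕ) = 2 ^ 2 by norm_num, ← pow_mul]
  exact Nat.choose_le_two_pow _ _

/-- The same table of trees serves the blocks of `A` and, with the sequence `A ∘ M` of block maxima,
the superblocks. -/
theorem exists_directory {n w b : ℕ} (hn : n < 2 ^ w) (hb : 0 < b)
    (hsize : directorySize n b ≤ 2 ^ w) (A : ℕ → β) :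
    ∃ I : List (BitVec w), I.length = directorySize n b ∧
      ∃ o₁ oM o₂ oL oG,
        IsDirectory w n (fun a => (I.getD a 0).toNat) A b o₁ oM o₂ oL oG := by
  classical
  choose! mx hmx hmx' using fun x y (h : x < y) => exists_max_Ico A h
  let M : ℕ → ℕ := fun k => mx (k * b) ((k + 1) * b)
  choose τ₁ hτ₁ hτ₁' using exists_cartesianTree A b
  choose τ₂ hτ₂ hτ₂' using exists_cartesianTree (A ∘ M) b
  let trees : List (BinaryTree Unit) := (BinaryTree.treesOfNumNodesEq b).toList
  let code : BinaryTree Unit → ℕ := fun τ => trees.idxOf τ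
  have hcode : ∀ τ : BinaryTree Unit, τ.numNodes = b →
      code τ < 4 ^ b ∧ trees.getD (code τ) .nil = τ := by
    intro τ hτ
    have hmem : τ ∈ trees := by
      rw [Finset.mem_toList, BinaryTree.mem_treesOfNumNodesEq, hτ]
    have hlt : code τ < trees.length := List.idxOf_lt_length_of_mem hmem
    refine ⟨hlt.trans_le ?_, ?_⟩
    · rw [Finset.length_toList]
      exact card_trees_le b
    · rw [List.getD_eq_getElem _ _ hlt]
      exact List.getElem_idxOf hlt
  obtain ⟨N₃, hN₃⟩ : ∃ N, N = n / (b * b) := ⟨_, rfl⟩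
  obtain ⟨N₂, hN₂⟩ : ∃ N, N = n / b := ⟨_, rfl⟩
  obtain ⟨oM, hoM⟩ : ∃ o, o = 6 + (N₂ + 1) := ⟨_, rfl⟩
  obtain ⟨o₂, ho₂⟩ : ∃ o, o = oM + N₂ := ⟨_, rfl⟩
  obtain ⟨oL, hoL⟩ : ∃ o, o = o₂ + (N₃ + 1) := ⟨_, rfl⟩
  obtain ⟨oG, hoG⟩ : ∃ o, o = oL + (N₃ + 1) := ⟨_, rfl⟩
  obtain ⟨oT, hoT⟩ : ∃ o, o = oG + (N₃ + 1) := ⟨_, rfl⟩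
  obtain ⟨oS, hoS⟩ : ∃ o, o = oT + 4 ^ b * (b * b) := ⟨_, rfl⟩
  let f₀ : ℕ → ℕ := fun a => [b, 6, oM, o₂, oL, oG].getD a 0
  -- A type is stored as the absolute address of its part of the table. There is one type more than
  -- there are complete blocks, for the incomplete last block.
  let f₁ : ℕ → ℕ := fun k => oT + code (τ₁ (k * b)) * (b * b)
  let f₂ : ℕ → ℕ := fun k => oT + code (τ₂ (k * b)) * (b * b)
  -- The machine has no logarithm instruction, so for each length `m` the row of the sparse table
  -- and the shift to the second window are tabulated.
  let fL : ℕ → ℕ := fun m => oS + Nat.log 2 m * N₃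
  let fG : ℕ → ℕ := fun m => m - 2 ^ Nat.log 2 m
  let fT : ℕ → ℕ := fun a =>
    treeQuery (trees.getD (a / (b * b)) .nil) (a % (b * b) / b) (a % (b * b) % b)
  let fS : ℕ → ℕ := fun a => mx (a % N₃ * (b * b)) ((a % N₃ + 2 ^ (a / N₃)) * (b * b))
  let F : ℕ → ℕ := layout [(6, f₀), (N₂ + 1, f₁), (N₂, M), (N₃ + 1, f₂), (N₃ + 1, fL),
    (N₃ + 1, fG), (4 ^ b * (b * b), fT), ((Nat.log 2 n + 1) * N₃, fS)]
  have htot : directorySize n b = oS + (Nat.log 2 n + 1) * N₃ := by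
    rw [directorySize, ← hN₂, ← hN₃]
    omega
  refine ⟨(List.range (directorySize n b)).map fun a => BitVec.ofNat w (F a), by simp,
    6, oM, o₂, oL, oG, ?_⟩
  rw [htot] at hsize ⊢
  have hg : ∀ a v, a < oS + (Nat.log 2 n + 1) * N₃ → F a = v → v < 2 ^ w →
      (((List.range (oS + (Nat.log 2 n + 1) * N₃)).map fun a => BitVec.ofNat w (F a)).getD a
        0).toNat = v := by
    intro a v ha hF hv
    rw [List.getD_eq_getElem _ _ (by simpa using ha)]
    simp [hF, Nat.mod_eq_of_lt hv]
  generalize hgdef : (fun a => (((List.range (oS + (Nat.log 2 n + 1) * N₃)).map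
    fun a => BitVec.ofNat w (F a)).getD a 0).toNat) = g
  replace hg : ∀ a v, a < oS + (Nat.log 2 n + 1) * N₃ → F a = v → v < 2 ^ w → g a = v := by
    rw [← hgdef]
    exact hg
  clear hgdef htot
  have hbb : b ≤ b * b := Nat.le_mul_of_pos_left b hb
  have hbb' : b * b ≤ 4 ^ b * (b * b) := Nat.le_mul_of_pos_left _ (by positivity)
  have g₀ : ∀ a v, a < 6 → f₀ a = v → v < 2 ^ w → g a = v := fun a v ha hv hw =>
    hg a v (by omega) (by rw [← hv]; exact layout_lt ha) hw
  have g₁ : ∀ k < N₂ + 1, f₁ k < 2 ^ w → g (6 + k) = f₁ k := fun k hk hw =>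
    hg _ _ (by omega) (by simp only [F]; rw [layout_add, layout_lt hk]) hw
  have gM : ∀ k < N₂, M k < 2 ^ w → g (oM + k) = M k := fun k hk hw =>
    hg _ _ (by omega) (by
      simp only [F, hoM, add_assoc 6]
      rw [layout_add, layout_add, layout_lt hk]) hw
  have g₂ : ∀ k < N₃ + 1, f₂ k < 2 ^ w → g (o₂ + k) = f₂ k := fun k hk hw =>
    hg _ _ (by omega) (by
      rw [show o₂ + k = 6 + ((N₂ + 1) + (N₂ + k)) by omega]
      simp only [F]
      rw [layout_add, layout_add, layout_add, layout_lt hk]) hw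
  have gL : ∀ k < N₃ + 1, fL k < 2 ^ w → g (oL + k) = fL k := fun k hk hw =>
    hg _ _ (by omega) (by
      rw [show oL + k = 6 + ((N₂ + 1) + (N₂ + ((N₃ + 1) + k))) by omega]
      simp only [F]
      rw [layout_add, layout_add, layout_add, layout_add, layout_lt hk]) hw
  have gG : ∀ k < N₃ + 1, fG k < 2 ^ w → g (oG + k) = fG k := fun k hk hw =>
    hg _ _ (by omega) (by
      rw [show oG + k = 6 + ((N₂ + 1) + (N₂ + ((N₃ + 1) + ((N₃ + 1) + k)))) by omega]
      simp only [F]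
      rw [layout_add, layout_add, layout_add, layout_add, layout_add, layout_lt hk]) hw
  have gT : ∀ k < 4 ^ b * (b * b), fT k < 2 ^ w → g (oT + k) = fT k := fun k hk hw =>
    hg _ _ (by omega) (by
      rw [show oT + k = 6 + ((N₂ + 1) + (N₂ + ((N₃ + 1) + ((N₃ + 1) + ((N₃ + 1) + k)))))
        by omega]
      simp only [F]
      rw [layout_add, layout_add, layout_add, layout_add, layout_add, layout_add, layout_lt hk]) hw
  have gS : ∀ k < (Nat.log 2 n + 1) * N₃, fS k < 2 ^ w → g (oS + k) = fS k := fun k hk hw =>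
    hg _ _ (by omega) (by
      rw [show oS + k = 6 + ((N₂ + 1) + (N₂ + ((N₃ + 1) + ((N₃ + 1) + ((N₃ + 1) +
        (4 ^ b * (b * b) + k)))))) by omega]
      simp only [F]
      rw [layout_add, layout_add, layout_add, layout_add, layout_add, layout_add, layout_add,
        layout_lt hk]) hw
  have query : ∀ τ : BinaryTree Unit, τ.numNodes = b → ∀ i j, i ≤ j → j < b → treeQuery τ i j ≤ j →
      oT + code τ * (b * b) < 2 ^ w ∧ oT + code τ * (b * b) + (i * b + j) < 2 ^ w ∧
        g (oT + code τ * (b * b) + (i * b + j)) = treeQuery τ i j := by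
    intro τ hτ i j hij hj hq
    have hij' : i * b + j < b * b := by
      have : (i + 1) * b ≤ b * b := Nat.mul_le_mul_right b (by omega)
      rw [add_one_mul] at this
      omega
    have hc := hcode τ hτ
    have hk : code τ * (b * b) + (i * b + j) < 4 ^ b * (b * b) := by
      have : (code τ + 1) * (b * b) ≤ 4 ^ b * (b * b) := Nat.mul_le_mul_right _ hc.1
      rw [add_one_mul] at this
      omega
    have hfT : fT (code τ * (b * b) + (i * b + j)) = treeQuery τ i j := by
      simp only [fT]
      rw [mul_comm (code τ), Nat.mul_add_div (by positivity), Nat.mul_add_mod,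
        Nat.div_eq_of_lt hij', Nat.mod_eq_of_lt hij', add_zero, hc.2, mul_comm i,
        Nat.mul_add_div hb, Nat.mul_add_mod, Nat.div_eq_of_lt hj, Nat.mod_eq_of_lt hj, add_zero]
    refine ⟨by omega, by omega, ?_⟩
    rw [add_assoc, gT _ hk (by omega), hfT]
  have full : ∀ k, (k + 1) * b ≤ n → k < N₂ ∧ (k * b ≤ M k ∧ M k < (k + 1) * b) ∧
      g (oM + k) = M k := by
    intro k hk
    have h₁ : k < N₂ := hN₂ ▸ (Nat.le_div_iff_mul_le hb).2 hk
    have h₂ : k * b ≤ M k ∧ M k < (k + 1) * b := hmx (k * b) ((k + 1) * b) (by rw [add_one_mul]; omega)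
    exact ⟨h₁, h₂, gM k h₁ (by omega)⟩
  refine ⟨hb, ⟨?_, ?_, ?_, ?_, ?_, ?_⟩, by omega, ?_, ?_, ?_, ?_⟩
  · exact g₀ 0 _ (by omega) rfl (by omega)
  · exact g₀ 1 _ (by omega) rfl (by omega)
  · exact g₀ 2 _ (by omega) rfl (by omega)
  · exact g₀ 3 _ (by omega) rfl (by omega)
  · exact g₀ 4 _ (by omega) rfl (by omega)
  · exact g₀ 5 _ (by omega) rfl (by omega)
  · intro k i j hij hj hkn
    obtain ⟨⟨q₁, q₂⟩, q₃⟩ := hτ₁' (k * b) i j hij hj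
    obtain ⟨a₁, a₂, a₃⟩ := query _ (hτ₁ (k * b)) i j hij hj q₂
    have hk : k < N₂ + 1 := by
      rw [hN₂, Nat.lt_succ_iff, Nat.le_div_iff_mul_le hb]
      omega
    rw [g₁ k hk a₁]
    simp only [f₁, a₃]
    exact ⟨by omega, a₂, q₁, q₂, q₃⟩
  · intro k hk
    obtain ⟨h₁, h₂, h₃⟩ := full k hk
    rw [h₃]
    exact ⟨by omega, h₂.1, h₂.2, hmx' _ _ (h₂.1.trans_lt h₂.2)⟩
  · intro k i j hij hj hkn
    obtain ⟨⟨q₁, q₂⟩, q₃⟩ := hτ₂' (k * b) i j hij hj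
    obtain ⟨a₁, a₂, a₃⟩ := query _ (hτ₂ (k * b)) i j hij hj q₂
    have hk : k < N₃ + 1 := by
      rw [hN₃, Nat.lt_succ_iff, Nat.le_div_iff_mul_le (by positivity), ← mul_assoc]
      exact (Nat.mul_le_mul_right b (by omega)).trans hkn
    have hfull : ∀ q, q ≤ j → g (oM + (k * b + q)) = M (k * b + q) := fun q hq =>
      (full _ ((Nat.mul_le_mul_right b (by omega)).trans hkn)).2.2
    rw [g₂ k hk a₁]
    simp only [f₂, a₃]
    refine ⟨by omega, a₂, q₁, q₂, fun q hq hq' => ?_⟩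
    rw [hfull q hq', hfull _ q₂]
    exact q₃ q hq hq'
  · intro u v huv hv
    have hvN : v ≤ N₃ := by
      rw [hN₃, Nat.le_div_iff_mul_le (by positivity)]
      exact hv
    have hN₃n : N₃ ≤ n := hN₃ ▸ Nat.div_le_self _ _
    obtain ⟨m, hm⟩ : ∃ m, m = v - u := ⟨_, rfl⟩
    obtain ⟨t, ht⟩ : ∃ t, t = Nat.log 2 m := ⟨_, rfl⟩
    have ht₁ : 2 ^ t ≤ m := by
      rw [ht]
      exact Nat.pow_log_le_self 2 (by omega)
    have ht₂ : m < 2 ^ t + 2 ^ t := by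
      rw [ht, ← two_mul, ← pow_succ']
      exact Nat.lt_pow_succ_log_self (by norm_num) m
    have htn : t ≤ Nat.log 2 n := by
      rw [ht]
      exact Nat.log_mono_right (by omega)
    have htN : (t + 1) * N₃ ≤ (Nat.log 2 n + 1) * N₃ := Nat.mul_le_mul_right _ (by omega)
    rw [add_one_mul] at htN
    have entry : ∀ z, z + 2 ^ t ≤ v → z * (b * b) < (z + 2 ^ t) * (b * b) ∧ oS + t * N₃ + z < 2 ^ w ∧
        g (oS + t * N₃ + z) = mx (z * (b * b)) ((z + 2 ^ t) * (b * b)) := by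
      intro z hz
      have hpos : 0 < 2 ^ t := by positivity
      have h₁ : z * (b * b) < (z + 2 ^ t) * (b * b) :=
        Nat.mul_lt_mul_of_pos_right (by omega) (by positivity)
      have h₂ : (z + 2 ^ t) * (b * b) ≤ v * (b * b) := Nat.mul_le_mul_right _ hz
      have h₃ := (hmx _ _ h₁).2
      have hfS : fS (t * N₃ + z) = mx (z * (b * b)) ((z + 2 ^ t) * (b * b)) := by
        have hzN : z < N₃ := by omega
        simp only [fS]
        rw [mul_comm t, Nat.mul_add_div (by omega), Nat.mul_add_mod, Nat.div_eq_of_lt hzN,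
          Nat.mod_eq_of_lt hzN, add_zero]
      refine ⟨h₁, by omega, ?_⟩
      rw [add_assoc, gS _ (by omega) (by omega), hfS]
    have hL : g (oL + m) = oS + t * N₃ := by
      rw [gL m (by omega)] <;> simp only [fL, ← ht]
      omega
    have hG : g (oG + m) = m - 2 ^ t := by
      rw [gG m (by omega)] <;> simp only [fG, ← ht]
      omega
    rw [← hm, hL, hG]
    obtain ⟨e₁, e₂, e₃⟩ := entry u (by omega)
    obtain ⟨e₁', e₂', e₃'⟩ := entry (v - 2 ^ t) (by omega)
    rw [show oS + t * N₃ + u + (m - 2 ^ t) = oS + t * N₃ + (v - 2 ^ t) by omega, e₃, e₃']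
    rw [Nat.sub_add_cancel (by omega)] at e₁' ⊢
    have l₁ : (u + 2 ^ t) * (b * b) ≤ v * (b * b) := Nat.mul_le_mul_right _ (by omega)
    have l₂ : u * (b * b) ≤ (v - 2 ^ t) * (b * b) := Nat.mul_le_mul_right _ (by omega)
    -- As `m` is below 2 · 2^t, the window that starts at `u` and the one that ends at `v` leave no
    -- gap.
    have l₃ : (v - 2 ^ t) * (b * b) ≤ (u + 2 ^ t) * (b * b) := Nat.mul_le_mul_right _ (by omega)
    have m₁ := hmx _ _ e₁
    have m₂ := hmx _ _ e₁'
    refine ⟨by omega, by omega, e₂, e₂', ⟨m₁.1, by omega⟩, ⟨by omega, m₂.2⟩, fun q hq hq' => ?_⟩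
    by_cases hqu : q < (u + 2 ^ t) * (b * b)
    · exact Or.inl (hmx' _ _ e₁ q hq hqu)
    · exact Or.inr (hmx' _ _ e₁' q (by omega) hq')

end Construction
end RangeReport

namespace RangeReport

/-! ### The recursive procedure of part (b). -/

section Recursion

variable {n : ℕ} {α : Type u} [LinearOrder α] {A : Fin n → α} {q : Fin n → Fin n → Fin n} {t : α}

theorem RangeRun.exists_run (hq : IsRMQ A q) (t : α) (m : ℕ) :
    ∀ x y : ℤ, 0 ≤ x → y < n → y + 1 - x ≤ m → ∃ ans c, RangeRun A q t x y ans c := by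
  induction m with
  | zero => exact fun x y _ _ h => ⟨∅, 1, .empty (by omega)⟩
  | succ m ih =>
    intro x y hx hy h
    rcases lt_or_ge y x with hyx | hxy
    · exact ⟨∅, 1, .empty hyx⟩
    obtain ⟨x, rfl⟩ : ∃ a : Fin n, x = (a : ℕ) := ⟨⟨x.toNat, by omega⟩, by simp; omega⟩
    obtain ⟨y, rfl⟩ : ∃ a : Fin n, y = (a : ℕ) := ⟨⟨y.toNat, by omega⟩, by simp; omega⟩
    have hxy : x ≤ y := by simpa using hxy
    by_cases ht : t ≤ A (q x y)
    · have hid := Finset.mem_Icc.1 (hq x y hxy).1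
      rw [Fin.le_def, Fin.le_def] at hid
      obtain ⟨ans₁, c₁, h₁⟩ := ih (x : ℕ) ((q x y : ℕ) - 1) (by omega) (by omega) (by omega)
      obtain ⟨ans₂, c₂, h₂⟩ := ih ((q x y : ℕ) + 1) (y : ℕ) (by omega) (by omega) (by omega)
      exact ⟨_, _, .split hxy ht h₁ h₂⟩
    · exact ⟨∅, 1, .reject hxy ht⟩

/-- The two recursive calls collect disjoint sets that omit the reported index, so with a₁ and a₂
elements the count is at most 1 + (2a₁ + 1) + (2a₂ + 1) = 2(a₁ + a₂ + 1) + 1. -/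
theorem RangeRun.correct (hq : IsRMQ A q) {x y : ℤ} {ans : Finset (Fin n)} {c : ℕ}
    (h : RangeRun A q t x y ans c) :
    (∀ k, k ∈ ans ↔ (x ≤ (k : ℕ) ∧ ((k : ℕ) : ℤ) ≤ y) ∧ t ≤ A k) ∧ c ≤ 2 * ans.card + 1 := by
  induction h with
  | empty h =>
    refine ⟨fun k => ?_, by simp⟩
    simp only [Finset.notMem_empty, false_iff]
    omega
  | @reject x y hxy ht =>
    refine ⟨fun k => ?_, by simp⟩
    simp only [Finset.notMem_empty, false_iff]
    rintro ⟨hk, htk⟩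
    refine ht (htk.trans ((hq x y hxy).2 k (Finset.mem_Icc.2 ?_)))
    rw [Fin.le_def, Fin.le_def]
    omega
  | @split x y ans₁ ans₂ c₁ c₂ hxy ht _ _ ih₁ ih₂ =>
    have hid := Finset.mem_Icc.1 (hq x y hxy).1
    rw [Fin.le_def, Fin.le_def] at hid
    constructor
    · intro k
      rw [Finset.mem_insert, Finset.mem_union, ih₁.1, ih₂.1]
      constructor
      · rintro (rfl | ⟨hk, htk⟩ | ⟨hk, htk⟩)
        · exact ⟨by omega, ht⟩
        · exact ⟨by omega, htk⟩
        · exact ⟨by omega, htk⟩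
      · rintro ⟨hk, htk⟩
        rcases lt_trichotomy (k : ℕ) (q x y : ℕ) with h | h | h
        · exact Or.inr (Or.inl ⟨by omega, htk⟩)
        · exact Or.inl (Fin.ext h)
        · exact Or.inr (Or.inr ⟨by omega, htk⟩)
    · rw [Finset.card_insert_of_notMem, Finset.card_union_of_disjoint]
      · omega
      · rw [Finset.disjoint_left]
        intro k h₁ h₂
        rw [ih₁.1] at h₁
        rw [ih₂.1] at h₂
        omega
      · rw [Finset.mem_union, ih₁.1, ih₂.1]
        omega

end Recursion

/-! ### Space bound. -/

/-- The first bound makes all addresses fit into a word; the second turns words into bits. Both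
follow from size · b ≤ 11n, using b ≥ 12 for the first and L + 1 ≤ 6b for the second. -/
theorem directorySize_bound {n : ℕ} (h : 64 ≤ Nat.log 2 n) :
    directorySize n (Nat.log 2 n / 5) ≤ n ∧
      directorySize n (Nat.log 2 n / 5) * (Nat.log 2 n + 1) ≤ 66 * n := by
  have hn : 2 ^ Nat.log 2 n ≤ n := Nat.pow_log_le_self 2 (by rintro rfl; simp at h)
  rw [directorySize]
  generalize Nat.log 2 n = L at *
  obtain ⟨b, hb⟩ : ∃ b, b = L / 5 := ⟨_, rfl⟩
  rw [← hb]
  have hb12 : 12 ≤ b := by omega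
  have hL : L + 1 ≤ 6 * b := by omega
  have h₂ : n / b * b ≤ n := Nat.div_mul_le_self n b
  have h₃ : n / (b * b) * (b * b) ≤ n := Nat.div_mul_le_self n (b * b)
  -- This dictates the divisor 5: 4^b contributes 2b to the exponent of two, and each of the three
  -- factors b ≤ 2^b contributes b.
  have hT : 4 ^ b * (b * b) * b ≤ n := by
    refine le_trans ?_ hn
    have hlt : b ≤ 2 ^ b := Nat.lt_two_pow_self.le
    calc 4 ^ b * (b * b) * b = 4 ^ b * (b * b * b) := mul_assoc _ _ _
      _ ≤ 4 ^ b * (2 ^ b * 2 ^ b * 2 ^ b) :=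
        Nat.mul_le_mul_left _ (Nat.mul_le_mul (Nat.mul_le_mul hlt hlt) hlt)
      _ = 2 ^ (5 * b) := by
        rw [show (4 : ℕ) ^ b = 2 ^ (2 * b) by rw [pow_mul]; norm_num]
        ring
      _ ≤ 2 ^ L := Nat.pow_le_pow_right (by norm_num) (by omega)
  generalize n / b = N₂ at *
  generalize n / (b * b) = N₃ at *
  have hten : 10 * b ≤ n := by
    refine le_trans ?_ hT
    refine Nat.mul_le_mul_right b ?_
    have : 1 ≤ 4 ^ b := Nat.one_le_pow _ _ (by norm_num)
    nlinarith
  have hS : (L + 1) * N₃ * b ≤ 6 * n := by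
    calc (L + 1) * N₃ * b ≤ 6 * b * N₃ * b := by gcongr
      _ = 6 * (N₃ * (b * b)) := by ring
      _ ≤ 6 * n := by gcongr
  have h₃' : 3 * N₃ * b ≤ n := by
    calc 3 * N₃ * b ≤ b * N₃ * b := by gcongr; omega
      _ = N₃ * (b * b) := by ring
      _ ≤ n := h₃
  -- The five summands below contribute 1, 2, 1, 1 and 6 times n, in this order.
  have key : (6 + (N₂ + 1) + N₂ + (N₃ + 1) + (N₃ + 1) + (N₃ + 1) + 4 ^ b * (b * b) +
      (L + 1) * N₃) * b ≤ 11 * n := by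
    calc _ = 10 * b + 2 * (N₂ * b) + 3 * N₃ * b + 4 ^ b * (b * b) * b + (L + 1) * N₃ * b := by ring
      _ ≤ 11 * n := by omega
  generalize 6 + (N₂ + 1) + N₂ + (N₃ + 1) + (N₃ + 1) + (N₃ + 1) + 4 ^ b * (b * b) +
    (L + 1) * N₃ = S at *
  constructor
  · have : S * 12 ≤ S * b := Nat.mul_le_mul_left S hb12
    omega
  · calc S * (L + 1) ≤ S * (6 * b) := Nat.mul_le_mul_left S hL
      _ = 6 * (S * b) := by ring
      _ ≤ 66 * n := by omega

/-- The program that reports the elements of a range above a threshold. -/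
def reportProgram : Program := loopProgram 6 reportInit (reportStep searchRange) 3

theorem reportInit_within : reportInit.Within 6 := by
  simp [reportInit, Code.Within, Expr.Within]

theorem reportStep_within : (reportStep searchRange).Within 6 := by
  simp [reportStep, searchStep, scanStep, searchRange, searchSuper, tryIndex, inBlock, inSuper,
    sparseLeft, sparseRight, sparseEntry, typeQuery, firstSuper, lastSuper, firstBlock, lastBlock,
    secondBlock, penultBlock, lastIndex, blockSize, Code.Within, Expr.Within]

/-! ### Assembling the data structure and the program. -/

section Query

variable {n : ℕ} {α : Type u} [LinearOrder α]

/-- The threshold oracle as a function of natural numbers. -/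
def thresholdTest (A : Fin n → α) (t : α) (k : ℕ) : Bool :=
  if h : k < n then decide (t ≤ A ⟨k, h⟩) else false

/-- A sequence continued by a least element. -/
def extendBot (A : Fin n → α) (k : ℕ) : WithBot α :=
  if h : k < n then (A ⟨k, h⟩ : WithBot α) else ⊥

/-- Continuing the sequence by ⊥ makes acceptance an upward closed condition on values for all
natural numbers: ⊥ is below every threshold, just as the oracle rejects invalid indices. -/
theorem thresholdTest_eq_true {A : Fin n → α} {t : α} {k : ℕ} :
    thresholdTest A t k = true ↔ (t : WithBot α) ≤ extendBot A k := by
  rw [thresholdTest, extendBot]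
  split_ifs <;> simp

theorem map_answer (A : Fin n → α) (l r : Fin n) (t : α) :
    (answer A l r t).map Fin.valEmbedding = hits (thresholdTest A t) l (r + 1) := by
  ext k
  simp only [answer, Finset.mem_map, Finset.mem_filter, Finset.mem_Icc, Fin.valEmbedding_apply,
    mem_hits, Fin.le_def]
  constructor
  · rintro ⟨a, ⟨ha, hta⟩, rfl⟩
    exact ⟨by omega, by simpa [thresholdTest] using hta⟩
  · rintro ⟨hk, htk⟩
    have hkn : k < n := by omega
    exact ⟨⟨k, hkn⟩, ⟨by simp only; omega, by simpa [thresholdTest, hkn] using htk⟩, rfl⟩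

theorem pos_of_lt_two_pow {w : ℕ} (hn : n < 2 ^ w) (l : Fin n) : 0 < w := by
  rcases Nat.eq_zero_or_pos w with rfl | hw
  · have := l.isLt
    simp at hn
    omega
  · exact hw

theorem reportProgram_outputs {w : ℕ} (hn : n < 2 ^ w) (A : Fin n → α) {I : List (BitVec w)}
    {l r : Fin n} {t : α} {m T : ℕ}
    (h : ∀ σ, AtRange σ l (r + 1) (r + 1) → σ.out = [] →
      (reportStep searchRange).loopWp w (fun a => (I.getD a 0).toNat) (thresholdTest A t) 3
        (Reported (thresholdTest A t) l (r + 1)) m σ)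
    (hT : reportProgram.length * (m + 1) ≤ T) :
    ∃ out : List (BitVec w),
      OutputsWithin reportProgram I (thresholdOracle A t) (BitVec.ofNat w l) (BitVec.ofNat w r)
        T out ∧
      (out.map BitVec.toNat).Nodup ∧
      (out.map BitVec.toNat).toFinset = (answer A l r t).map Fin.valEmbedding := by
  have hw : 0 < w := pos_of_lt_two_pow hn l
  obtain ⟨out, hout, σ, ⟨hnd, hσ⟩, ho⟩ := loopProgram_outputs hw
    (accept := thresholdTest A t) (fun _ => rfl) (orc := thresholdOracle A t) (fun _ => rfl)
    (by norm_num) reportInit_within reportStep_within (l.isLt.trans hn) (r.isLt.trans hn)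
    (reportInit_wp hw hn r.isLt h) hT
  exact ⟨out, hout, ho ▸ hnd, by rw [ho, hσ, map_answer]⟩

theorem exists_dataStructure {w κ : ℕ} (hn : n < 2 ^ w) (hw : w ≤ κ * (Nat.log 2 n + 1))
    (A : Fin n → α) :
    ∃ I : List (BitVec w), I.length * w ≤ 66 * κ * n ∧
      ∀ (l r : Fin n) (t : α), l ≤ r →
        ∃ out : List (BitVec w),
          OutputsWithin reportProgram I (thresholdOracle A t)
            (BitVec.ofNat w l) (BitVec.ofNat w r)
            (reportProgram.length * (2 ^ 64 + 2) * ((answer A l r t).card + 1)) out ∧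
          (out.map BitVec.toNat).Nodup ∧
          (out.map BitVec.toNat).toFinset = (answer A l r t).map Fin.valEmbedding := by
  by_cases hL : 64 ≤ Nat.log 2 n
  · obtain ⟨hs₁, hs₂⟩ := directorySize_bound hL
    obtain ⟨I, hI, o₁, oM, o₂, oL, oG, D⟩ :=
      exists_directory hn (by omega) (hs₁.trans hn.le) (extendBot A)
    refine ⟨I, ?_, fun l r t hlr => ?_⟩
    · rw [hI]
      calc _ ≤ directorySize n (Nat.log 2 n / 5) * (κ * (Nat.log 2 n + 1)) :=
            Nat.mul_le_mul_left _ hw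
        _ = κ * (directorySize n (Nat.log 2 n / 5) * (Nat.log 2 n + 1)) := by ring
        _ ≤ κ * (66 * n) := Nat.mul_le_mul_left _ hs₂
        _ = 66 * κ * n := by ring
    · have hS := searches_searchRange (accept := thresholdTest A t) D hn fun i j hij hi =>
        thresholdTest_eq_true.2 ((thresholdTest_eq_true.1 hi).trans hij)
      refine reportProgram_outputs hn A (fun σ hσ ho =>
        loopWp_search hS (pos_of_lt_two_pow hn l) (D.head.1.symm ▸ D.pos) hn r.isLt hσ ho) ?_
      rw [← map_answer, Finset.card_map, mul_assoc]
      exact Nat.mul_le_mul_left _ (by omega)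
  -- Reading the empty data structure gives zero, which makes the program scan. For long sequences
  -- word 0 is the block length, which is positive.
  · refine ⟨[], by simp, fun l r t hlr => ?_⟩
    refine reportProgram_outputs hn A (fun σ hσ ho =>
      loopWp_scan (pos_of_lt_two_pow hn l) (by simp) hn r.isLt n (by omega) le_rfl
        (by rw [Fin.le_def] at hlr; omega) hσ ⟨by simp [ho], ?_⟩) ?_
    · rw [ho]
      ext k
      simp
    -- Scanning is allotted `n + 1` rounds, and initialization is charged as one more; this is the
    -- source of the constant 2^64 + 2.
    · have hn64 : n < 2 ^ 64 := Nat.lt_pow_of_log_lt (by norm_num) (by omega)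
      rw [mul_assoc]
      refine Nat.mul_le_mul_left _ ?_
      nlinarith

end Query
end RangeReport

theorem mainTheorem12 :
    (∀ κ : ℕ, ∃ (P : RangeReport.Program) (c C : ℕ),
      ∀ n w : ℕ, n < 2 ^ w → w ≤ κ * (Nat.log 2 n + 1) →
      ∀ (α : Type u) [LinearOrder α] (A : Fin n → α),
        ∃ I : List (BitVec w), I.length * w ≤ c * n ∧
          ∀ (l r : Fin n) (t : α), l ≤ r →
            ∃ out : List (BitVec w),
              RangeReport.OutputsWithin P I (RangeReport.thresholdOracle A t)
                (BitVec.ofNat w l) (BitVec.ofNat w r)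
                (C * ((RangeReport.answer A l r t).card + 1)) out ∧
              (out.map BitVec.toNat).Nodup ∧
              (out.map BitVec.toNat).toFinset =
                (RangeReport.answer A l r t).map Fin.valEmbedding) ∧
    (∀ (n : ℕ) (α : Type u) [LinearOrder α] (A : Fin n → α) (q : Fin n → Fin n → Fin n),
      RangeReport.IsRMQ A q → ∀ (l r : Fin n) (t : α), l ≤ r →
        (∃ (ans : Finset (Fin n)) (calls : ℕ),
          RangeReport.RangeRun A q t (l : ℕ) (r : ℕ) ans calls) ∧
        ∀ (ans : Finset (Fin n)) (calls : ℕ),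
          RangeReport.RangeRun A q t (l : ℕ) (r : ℕ) ans calls →
            ans = RangeReport.answer A l r t ∧
            calls ≤ 2 * (RangeReport.answer A l r t).card + 1) := by
  refine ⟨fun κ => ⟨RangeReport.reportProgram, 66 * κ,
    RangeReport.reportProgram.length * (2 ^ 64 + 2), fun n w hn hw α _ A =>
      RangeReport.exists_dataStructure hn hw A⟩, fun n α _ A q hq l r t _ => ⟨?_, ?_⟩⟩
  · exact RangeReport.RangeRun.exists_run hq t (n + 1) _ _ (by omega) (by omega) (by omega)
  · intro ans calls h
    obtain ⟨hmem, hcalls⟩ := h.correct hq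
    have : ans = RangeReport.answer A l r t := by
      ext k
      rw [hmem, RangeReport.answer, Finset.mem_filter, Finset.mem_Icc, Fin.le_def, Fin.le_def]
      simp
    exact ⟨this, this ▸ hcalls⟩
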